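/- **Setting.** For a finite set $S$ in a Euclidean space and $r>0$, let $G_r(S)$ be the graph with vertex set $S$ in which two distinct points are adjacent iff their distance is less than $r$. Let $\sigma(z)=\max(0,z)$, with the convention $\sigma'(z)=1_{\{z\ge 0\}}$. For $W\in\mathbb R^{m\times n}$ and $a\in\mathbb R^m$ consider the two-layer network $$\Phi_{W,a}(x)=\Big\langle a,\ \sigma\big(\tfrac1{\sqrt m}Wx\big)\Big\rangle ,\qquad x\in\mathbb R^n .$$ Given training data $(x_i,y_i)\in\mathbb R^n\times\mathbb R$, $i=1,\dots,N$, let $L(W,a)=\frac12\sum_{i=1}^N(\Phi_{W,a}(x_i)-y_i)^2$, and let $W(l)$ be the gradient descent iterates $W(l+1)=W(l)-\eta\,\frac{\partial L}{\partial W}(W(l),a)$, with $a$ kept fixed; here $\frac{\partial L}{\partial W}$ is computed by the chain rule with the above $\sigma'$. Let $u(0)=(\Phi_{W(0),a}(x_i))_{i=1}^N$ and $y=(y_i)_{i=1}^N$, and let $\lambda_0$ be the smallest eigenvalue of the Gram matrix $H^\infty\in\mathbb R^{N\times N}$, $$H^\infty_{ij}=\mathbb E_{w\sim\mathcal N(0,1)^n}\big[x_i^\top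 x_j\,1_{\{w^\top x_i\ge0,\ w^\top x_j\ge0\}}\big].$$ **Theorem.** There is an absolute constant $c>0$, and for every $C\in\mathbb R$ there is a constant $K>0$ depending only on $C$, such that the following holds. Let $n,N,m\in\mathbb N$ and let the training data satisfy $\|x_i\|=1$ and $|y_i|\le C$ for all $i$, and $\lambda_0>0$. Let $\delta>0$, and suppose that $$m\ \ge\ K\,\frac{N^6}{\lambda_0^4\,\delta^3},\qquad 0<\eta\le c\,\frac{\lambda_0}{N^2}.$$ Let the entries of $W(0)$ be standard normal and the entries of $a$ uniform on $\{-1,1\}$, all independent. Let $X\subset\mathbb R^n$ be a finite set, $r>0$ and $0<\epsilon<1$, and, with $N(x)$ the set of neighbours of $x$ in $G_r(X)$, assume that for every $x\in X$ $$\epsilon<\min\left\{\frac{r-\max_{z\in N(x)}\|x-z\|}{\max_{z\in N(x)}\|x-z\|},\ \frac{\min_{z\in X\setminus(N(x)\cup\{x\})}\|x-z\|-r}{\min_{z\in X\setminus(N(x)\cup\{x\})}\|x-z\|}\right\},$$ where a term whose maximum or minimum is over the empty set is omitted. Then, with probability at least $$1-\delta-|X|(|X|-1)\exp\left(\frac m4\Big(\frac{\epsilon^3}8-\frac{\epsilon^2}4\Big)\right)$$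 over the random initialization, the following implication holds: if $$m\ \ge\ \frac{64\,N\,\|u(0)-y\|^2}{\epsilon^2\lambda_0^2},$$ then for every number $l\ge0$ of gradient descent steps the map $\psi(x)=\frac1{\sqrt m}W(l)x$ is a graph isomorphism from $G_r(X)$ onto $G_r(\psi(X))$. -/

import Mathlib

open MeasureTheory ProbabilityTheory
open scoped Matrix

noncomputable section

namespace TrainedNet

/-- The `r`-neighbourhood graph on a set `S` of points of a metric space: two distinct points of `S`
are adjacent iff their distance is less than `r`. -/
def rGraph {E : Type*} [MetricSpace E] (r : ℝ) (S : Set E) : SimpleGraph S where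
  Adj x y := x ≠ y ∧ dist (x : E) (y : E) < r
  symm := ⟨fun x y h => ⟨h.1.symm, by rw [dist_comm]; exact h.2⟩⟩
  loopless := ⟨fun _ h => h.1 rfl⟩

/-- `f`, viewed as a map `S → f(S)`, is a graph isomorphism from the `r`-neighbourhood graph of `S`
to the `r`-neighbourhood graph of `f(S)`. -/
def IsRGraphIso {E F : Type*} [MetricSpace E] [MetricSpace F] (r : ℝ) (S : Set E) (f : E → F) :
    Prop :=
  ∃ φ : rGraph r S ≃g rGraph r (f '' S), ∀ x : S, ((φ x : f '' S) : F) = f x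

/-- The gap condition on `ε` at every vertex `x`: with `M` the largest distance from `x` to a
neighbour and `μ` the smallest distance from `x` to another vertex that is not a neighbour,
`ε < (r - M) / M` and `ε < (μ - r) / μ`. A maximum or minimum over an empty set imposes no
condition. -/
def GapCondition {E : Type*} [MetricSpace E] (r ε : ℝ) (S : Set E) : Prop :=
  ∀ x : S,
    (∀ M : ℝ, IsGreatest ((fun y : S => dist (x : E) (y : E)) '' (rGraph r S).neighborSet x) M →
      ε < (r - M) / M) ∧
    (∀ μ : ℝ, IsLeast ((fun y : S => dist (x : E) (y : E)) ''
        {y : S | y ≠ x ∧ y ∉ (rGraph r S).neighborSet x}) μ →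
      ε < (μ - r) / μ)

/-- The ReLU activation. -/
def relu (z : ℝ) : ℝ := max 0 z

/-- The derivative of ReLU, with the usual convention that its value at the kink is `1`. -/
def reluDeriv (z : ℝ) : ℝ := if 0 ≤ z then 1 else 0

/-- The pre-activation map `x ↦ W x / √m` of the hidden layer. -/
def preAct {m n : ℕ} (W : Matrix (Fin m) (Fin n) ℝ) (x : EuclideanSpace ℝ (Fin n)) :
    EuclideanSpace ℝ (Fin m) :=
  (1 / √(m : ℝ)) • WithLp.toLp 2 (W *ᵥ x.ofLp)

/-- The two-layer network `x ↦ ⟨a, σ(W x / √m)⟩`. -/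
def network {m n : ℕ} (W : Matrix (Fin m) (Fin n) ℝ) (a : Fin m → ℝ)
    (x : EuclideanSpace ℝ (Fin n)) : ℝ :=
  ∑ k, a k * relu (preAct W x k)

/-- The prediction vector on the training inputs. -/
def prediction {m n N : ℕ} (x : Fin N → EuclideanSpace ℝ (Fin n)) (a : Fin m → ℝ)
    (W : Matrix (Fin m) (Fin n) ℝ) : EuclideanSpace ℝ (Fin N) :=
  WithLp.toLp 2 fun i => network W a (x i)

/-- The empirical squared loss. -/
def loss {m n N : ℕ} (x : Fin N → EuclideanSpace ℝ (Fin n)) (y : EuclideanSpace ℝ (Fin N))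
    (a : Fin m → ℝ) (W : Matrix (Fin m) (Fin n) ℝ) : ℝ :=
  (1 / 2) * ∑ i, (network W a (x i) - y i) ^ 2

/-- The gradient `∂L/∂W` of the loss in the first-layer weights, by the chain rule, with
`reluDeriv` for the derivative of ReLU. -/
def lossGrad {m n N : ℕ} (x : Fin N → EuclideanSpace ℝ (Fin n)) (y : EuclideanSpace ℝ (Fin N))
    (a : Fin m → ℝ) (W : Matrix (Fin m) (Fin n) ℝ) : Matrix (Fin m) (Fin n) ℝ :=
  Matrix.of fun k j =>
    ∑ i, (network W a (x i) - y i) * (a k * reluDeriv (preAct W (x i) k) * (1 / √(m : ℝ) * x i j))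

/-- Sanity check: away from the kinks of ReLU, `lossGrad` consists of the partial derivatives of
`loss`. -/
theorem hasDerivAt_loss {m n N : ℕ} (x : Fin N → EuclideanSpace ℝ (Fin n))
    (y : EuclideanSpace ℝ (Fin N)) (a : Fin m → ℝ) (W : Matrix (Fin m) (Fin n) ℝ)
    (hW : ∀ i k, preAct W (x i) k ≠ 0) (k : Fin m) (j : Fin n) :
    HasDerivAt (fun t : ℝ => loss x y a (W + t • Matrix.single k j 1)) (lossGrad x y a W k j) 0 := by
  have hrelu : ∀ z : ℝ, z ≠ 0 → HasDerivAt relu (reluDeriv z) z := by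
    intro z hz
    rcases lt_or_gt_of_ne hz with h | h
    · have : reluDeriv z = 0 := by simp [reluDeriv, h]
      rw [this]
      refine (hasDerivAt_const z (0 : ℝ)).congr_of_eventuallyEq ?_
      filter_upwards [Iio_mem_nhds h] with w hw
      exact max_eq_left (le_of_lt hw)
    · have : reluDeriv z = 1 := by simp [reluDeriv, h.le]
      rw [this]
      refine (hasDerivAt_id z).congr_of_eventuallyEq ?_
      filter_upwards [Ioi_mem_nhds h] with w hw
      exact max_eq_right (le_of_lt hw)
  have hpre : ∀ i k', HasDerivAt
      (fun t : ℝ => preAct (W + t • Matrix.single k j 1) (x i) k')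
      (if k' = k then 1 / √(m : ℝ) * x i j else 0) 0 := by
    intro i k'
    have e : (fun t : ℝ => preAct (W + t • Matrix.single k j 1) (x i) k') =
        fun t : ℝ => preAct W (x i) k' + t * (if k' = k then 1 / √(m : ℝ) * x i j else 0) := by
      funext t
      simp only [preAct, Matrix.add_mulVec, Matrix.smul_mulVec, Matrix.single_mulVec,
        PiLp.smul_apply, Pi.add_apply, Pi.smul_apply, smul_eq_mul, Function.update_apply,
        Pi.zero_apply]
      split_ifs <;> ring
    rw [e]
    simpa using ((hasDerivAt_id (0 : ℝ)).mul_const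
      (if k' = k then 1 / √(m : ℝ) * x i j else 0)).const_add (preAct W (x i) k')
  have hnet : ∀ i, HasDerivAt (fun t : ℝ => network (W + t • Matrix.single k j 1) a (x i))
      (a k * reluDeriv (preAct W (x i) k) * (1 / √(m : ℝ) * x i j)) 0 := by
    intro i
    have h := HasDerivAt.fun_sum (u := Finset.univ) (fun k' _ =>
      ((HasDerivAt.comp (0 : ℝ) (h₂ := relu) (h₂' := reluDeriv (preAct W (x i) k'))
        (by simpa using hrelu _ (hW i k')) (hpre i k')).const_mul (a k')))
    exact h.congr_deriv (by simp [mul_assoc])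
  have h := (HasDerivAt.fun_sum (u := Finset.univ) (fun i _ =>
    (((hnet i).sub_const (y i)).pow 2))).const_mul (1 / 2 : ℝ)
  refine h.congr_deriv ?_
  simp only [lossGrad, Matrix.of_apply, Finset.mul_sum]
  refine Finset.sum_congr rfl fun i _ => ?_
  simp
  ring

/-- Gradient descent on the first-layer weights, with step size `η`, started at `W₀`; the
second-layer weights `a` stay fixed. -/
def gradDescent {m n N : ℕ} (x : Fin N → EuclideanSpace ℝ (Fin n))
    (y : EuclideanSpace ℝ (Fin N)) (a : Fin m → ℝ) (η : ℝ) (W₀ : Matrix (Fin m) (Fin n) ℝ) :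
    ℕ → Matrix (Fin m) (Fin n) ℝ
  | 0 => W₀
  | l + 1 => gradDescent x y a η W₀ l - η • lossGrad x y a (gradDescent x y a η W₀ l)

/-- The Gram matrix
`H i j = 𝔼_{w ∼ N(0,1)ⁿ} [ ⟨xᵢ, xⱼ⟩ 1{⟨w, xᵢ⟩ ≥ 0, ⟨w, xⱼ⟩ ≥ 0} ]`. -/
def gramMatrix {n N : ℕ} (x : Fin N → EuclideanSpace ℝ (Fin n)) : Matrix (Fin N) (Fin N) ℝ :=
  Matrix.of fun i j =>
    ∫ w, Set.indicator {w : Fin n → ℝ | 0 ≤ w ⬝ᵥ (x i).ofLp ∧ 0 ≤ w ⬝ᵥ (x j).ofLp}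
      (fun _ => (x i).ofLp ⬝ᵥ (x j).ofLp) w ∂(Measure.pi fun _ : Fin n => gaussianReal 0 1)

/-- The smallest eigenvalue of the Gram matrix, which is real symmetric. -/
def lambdaMin {n N : ℕ} (x : Fin N → EuclideanSpace ℝ (Fin n)) : ℝ :=
  sInf (spectrum ℝ (gramMatrix x))

/-- Random initialization: the entries of the first-layer weight matrix `W₀` are standard normal,
those of the second-layer weight vector `a` are uniform on `{-1, 1}`, and all these random
variables are independent. -/
structure IsRandomInit {Ω : Type*} [MeasurableSpace Ω] (P : Measure Ω) {m n : ℕ}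
    (W₀ : Ω → Matrix (Fin m) (Fin n) ℝ) (a : Ω → Fin m → ℝ) : Prop where
  law_W : ∀ k j, HasLaw (fun ω => W₀ ω k j) (gaussianReal 0 1) P
  law_a : ∀ k, HasLaw (fun ω => a ω k) (uniformOn ({-1, 1} : Set ℝ)) P
  indep : iIndepFun
    (Sum.elim (fun p : Fin m × Fin n => fun ω => W₀ ω p.1 p.2) (fun k : Fin m => fun ω => a ω k)) P

end TrainedNet

end

/-!
The proof combines two facts about wide random two-layer networks.

*The random hidden layer is a near-isometry on `X`.* For a unit vector `v` the pre-activations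
`wₖᵀv` are independent standard normal variables, so `m ‖W(0)v/√m‖²` has the chi-square distribution
with `m` degrees of freedom. The Chernoff bound (`measureReal_sum_sq_not_mem_le`) and a union bound
over the pairs in `X` show that `W(0)/√m` distorts all distances in `X` by a factor in
`[1 - ε/2, 1 + ε/2]`, up to the exponentially small probability of the theorem
(`IsRandomInit.measureReal_johnsonLindenstrauss`).

*Training hardly moves the hidden layer.* As long as each row of `W` stays within a small distance
`R` of its initial value, a neuron can change its activation at `xᵢ` only if `|wₖ(0)ᵀxᵢ| ≤ R`; such
neurons are called unstable. Up to an error from the unstable neurons, a gradient step maps the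
residual `r` to `r - η G r`, with `G` the empirical Gram matrix. With high probability `G` is close
to `H^∞` at the initialization (second moments) and few neurons are unstable (anti-concentration of
the normal distribution). Hence `G` stays coercive, the residual decays geometrically, and the
gradients, which are bounded by the residual, sum up to a displacement of at most
`D = 4 √N ‖u(0) - y‖ / (√m λ₀)` for every row. The assumption on `m` makes `D ≤ R`, so that the
argument closes by induction (`gradDescent_invariant`). Markov's inequality suffices for all three
probabilistic inputs, which accounts for the powers of `δ`.

A row displacement of `D` changes `W/√m` by at most `D` in operator norm, and `D ≤ ε/2` is exactly
the hypothesis of the implication. So `W(l)/√m` distorts distances in `X` by a factor in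
`[1 - ε, 1 + ε]`, and the gap condition says that this leaves the neighbourhood graph unchanged
(`isRGraphIso_of_distortion`).
-/

noncomputable section

namespace TrainedNet

/-! ### Neighbourhood graphs under near-isometries -/

section

/-- A map distorting all distances within `S` by a factor in `[1 - ε, 1 + ε]` leaves the
`r`-neighbourhood graph unchanged if `S` has no distances in the window around `r` that
`GapCondition` rules out. -/
theorem isRGraphIso_of_distortion {E F : Type*} [MetricSpace E] [MetricSpace F] {r ε : ℝ}
    {S : Set E} (hS : S.Finite) (hε : ε < 1) (hgap : GapCondition r ε S) {f : E → F}
    (hlow : ∀ x ∈ S, ∀ y ∈ S, (1 - ε) * dist x y ≤ dist (f x) (f y))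
    (hupp : ∀ x ∈ S, ∀ y ∈ S, dist (f x) (f y) ≤ (1 + ε) * dist x y) (hε0 : 0 < ε) :
    IsRGraphIso r S f := by
  have : Finite S := hS
  have hinj : Set.InjOn f S := by
    intro x hx y hy hxy
    have h := hlow x hx y hy
    rw [hxy, dist_self] at h
    have h' : dist x y ≤ 0 := by nlinarith [sub_pos.2 hε]
    exact dist_le_zero.1 h'
  have hadj : ∀ x y : S, x ≠ y → (dist (f x) (f y) < r ↔ dist (x : E) y < r) := by
    intro x y hxy
    have hpos : 0 < dist (x : E) y := dist_pos.2 fun h => hxy (Subtype.ext h)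
    constructor
    · intro h
      by_contra hr
      have hfin : ((fun y : S => dist (x : E) (y : E)) ''
        {y : S | y ≠ x ∧ y ∉ (rGraph r S).neighborSet x}).Finite := Set.toFinite _
      have hmem : y ∈ {y : S | y ≠ x ∧ y ∉ (rGraph r S).neighborSet x} :=
        ⟨hxy.symm, fun h => hr h.2⟩
      obtain ⟨μ, hμ⟩ := hfin.exists_minimal ⟨_, y, hmem, rfl⟩
      have hleast : IsLeast ((fun y : S => dist (x : E) (y : E)) ''
        {y : S | y ≠ x ∧ y ∉ (rGraph r S).neighborSet x}) μ :=
        ⟨hμ.1, fun z hz => (le_total μ z).elim id (hμ.2 hz)⟩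
      have hg := (hgap x).2 μ hleast
      obtain ⟨z, hz, rfl⟩ := hμ.1
      have hzpos : 0 < dist (x : E) z := dist_pos.2 fun h => hz.1 (Subtype.ext h.symm)
      have hle : dist (x : E) z ≤ dist (x : E) y := hleast.2 ⟨y, hmem, rfl⟩
      rw [lt_div_iff₀ hzpos] at hg
      have := hlow x x.2 y y.2
      nlinarith [sub_pos.2 hε]
    · intro h
      have hfin : ((fun y : S => dist (x : E) (y : E)) '' (rGraph r S).neighborSet x).Finite :=
        Set.toFinite _
      have hmem : y ∈ (rGraph r S).neighborSet x := ⟨hxy, h⟩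
      obtain ⟨M, hM⟩ := hfin.exists_maximal ⟨_, y, hmem, rfl⟩
      have hgr : IsGreatest ((fun y : S => dist (x : E) (y : E)) ''
        (rGraph r S).neighborSet x) M :=
        ⟨hM.1, fun z hz => (le_total z M).elim id (hM.2 hz)⟩
      have hg := (hgap x).1 M hgr
      have hle : dist (x : E) y ≤ M := hgr.2 ⟨y, hmem, rfl⟩
      rw [lt_div_iff₀ (hpos.trans_le hle)] at hg
      have := hupp x x.2 y y.2
      nlinarith
  refine ⟨⟨Equiv.Set.imageOfInjOn f S hinj, ?_⟩, fun x => rfl⟩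
  intro x y
  change ((_ ≠ _) ∧ dist (f x) (f y) < r) ↔ x ≠ y ∧ dist (x : E) y < r
  rw [(Equiv.Set.imageOfInjOn f S hinj).injective.ne_iff]
  exact and_congr_right fun h => hadj x y h

end

/-! ### The network near its initialization -/

section

variable {m n N : ℕ}

/-- The `k`-th row of a weight matrix, as a Euclidean vector. -/
def row (W : Matrix (Fin m) (Fin n) ℝ) (k : Fin m) : EuclideanSpace ℝ (Fin n) :=
  WithLp.toLp 2 (W k)

/-- The empirical Gram matrix of the network: its entries are the averages over the neurons `k` of
`⟨xᵢ, xⱼ⟩ 1{wₖᵀxᵢ ≥ 0, wₖᵀxⱼ ≥ 0}`. -/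
def empGram (x : Fin N → EuclideanSpace ℝ (Fin n)) (W : Matrix (Fin m) (Fin n) ℝ)
    (i j : Fin N) : ℝ :=
  1 / (m : ℝ) * ∑ k, inner ℝ (x i) (x j) *
    (reluDeriv (inner ℝ (row W k) (x i)) * reluDeriv (inner ℝ (row W k) (x j)))

/-- The indicator that neuron `k` may change its activation at the input `x` when its weight vector
moves by at most `R`. -/
def unstable (W : Matrix (Fin m) (Fin n) ℝ) (R : ℝ) (x : EuclideanSpace ℝ (Fin n)) (k : Fin m) :
    ℝ :=
  if |inner ℝ (row W k) x| ≤ R then 1 else 0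

/-- The proportion of neurons that are unstable at an input, summed over the inputs. -/
def unstableFrac (x : Fin N → EuclideanSpace ℝ (Fin n)) (W : Matrix (Fin m) (Fin n) ℝ)
    (R : ℝ) : ℝ :=
  ∑ i, 1 / (m : ℝ) * ∑ k, unstable W R (x i) k

theorem unstable_nonneg (W : Matrix (Fin m) (Fin n) ℝ) (R : ℝ) (x : EuclideanSpace ℝ (Fin n))
    (k : Fin m) : 0 ≤ unstable W R x k := by
  unfold unstable; split_ifs <;> norm_num

theorem unstableFrac_nonneg (x : Fin N → EuclideanSpace ℝ (Fin n))
    (W : Matrix (Fin m) (Fin n) ℝ) (R : ℝ) : 0 ≤ unstableFrac x W R :=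
  Finset.sum_nonneg fun _ _ => mul_nonneg (by positivity)
    (Finset.sum_nonneg fun _ _ => unstable_nonneg _ _ _ _)

theorem preAct_apply (W : Matrix (Fin m) (Fin n) ℝ) (x : EuclideanSpace ℝ (Fin n)) (k : Fin m) :
    preAct W x k = 1 / √(m : ℝ) * inner ℝ (row W k) x := by
  simp [preAct, row, Matrix.mulVec, dotProduct, PiLp.inner_apply, mul_comm]

theorem preAct_sub (W : Matrix (Fin m) (Fin n) ℝ) (x y : EuclideanSpace ℝ (Fin n)) :
    preAct W (x - y) = preAct W x - preAct W y := by
  ext k; simp [preAct_apply, inner_sub_right, mul_sub]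

theorem reluDeriv_mul_of_pos {c : ℝ} (hc : 0 < c) (z : ℝ) : reluDeriv (c * z) = reluDeriv z := by
  simp [reluDeriv, mul_nonneg_iff_of_pos_left hc]

theorem reluDeriv_nonneg (z : ℝ) : 0 ≤ reluDeriv z := by
  unfold reluDeriv; split_ifs <;> norm_num

theorem reluDeriv_le_one (z : ℝ) : reluDeriv z ≤ 1 := by
  unfold reluDeriv; split_ifs <;> norm_num

theorem reluDeriv_preAct (hm : 0 < m) (W : Matrix (Fin m) (Fin n) ℝ)
    (x : EuclideanSpace ℝ (Fin n)) (k : Fin m) :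
    reluDeriv (preAct W x k) = reluDeriv (inner ℝ (row W k) x) := by
  rw [preAct_apply, reluDeriv_mul_of_pos]
  have : (0 : ℝ) < m := by exact_mod_cast hm
  positivity

theorem abs_inner_row_sub_le {W W₀ : Matrix (Fin m) (Fin n) ℝ} {R : ℝ}
    {x : EuclideanSpace ℝ (Fin n)} (hx : ‖x‖ = 1) {k : Fin m}
    (h : ‖row W k - row W₀ k‖ ≤ R) : |inner ℝ (row W k) x - inner ℝ (row W₀ k) x| ≤ R := by
  rw [← inner_sub_left]
  exact (abs_real_inner_le_norm _ _).trans (by rw [hx, mul_one]; exact h)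

/-- Activations of stable neurons do not change. -/
theorem abs_reluDeriv_sub_le {z z₀ R : ℝ} (h : |z - z₀| ≤ R) :
    |reluDeriv z - reluDeriv z₀| ≤ if |z₀| ≤ R then 1 else 0 := by
  rw [abs_le] at h
  simp only [abs_le]
  unfold reluDeriv
  split_ifs <;> norm_num <;> grind

/-- The linearization of ReLU is exact between two points close to a common stable point. -/
theorem abs_relu_sub_le {z z' z₀ R : ℝ} (h : |z - z₀| ≤ R) (h' : |z' - z₀| ≤ R) :
    |relu z' - relu z - reluDeriv z * (z' - z)| ≤ (if |z₀| ≤ R then 1 else 0) * |z' - z| := by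
  rw [abs_le] at h h'
  unfold reluDeriv relu
  simp only [abs_le (a := z₀)]
  rcases max_cases 0 z' with ⟨h1, h2⟩ | ⟨h1, h2⟩ <;>
  rcases max_cases 0 z with ⟨h3, h4⟩ | ⟨h3, h4⟩ <;> rw [h1, h3] <;>
  split_ifs <;> rw [abs_le] <;> constructor <;>
  rcases abs_cases (z' - z) with ⟨h5, h6⟩ | ⟨h5, h6⟩ <;> rw [h5] <;> grind

theorem relu_mul_of_nonneg {c : ℝ} (hc : 0 ≤ c) (z : ℝ) : relu (c * z) = c * relu z := by
  unfold relu
  rw [mul_max_of_nonneg _ _ hc, mul_zero]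

theorem sum_abs_le_sqrt_mul_norm (r : EuclideanSpace ℝ (Fin N)) : ∑ i, |r i| ≤ √N * ‖r‖ := by
  have h := Finset.sum_mul_sq_le_sq_mul_sq Finset.univ (fun _ : Fin N => (1 : ℝ)) (fun i => |r i|)
  rw [← Real.sqrt_sq (Finset.sum_nonneg fun i _ => abs_nonneg (r i)), EuclideanSpace.norm_eq,
    ← Real.sqrt_mul (Nat.cast_nonneg N)]
  apply Real.sqrt_le_sqrt
  simpa using h

theorem norm_le_sum_abs (r : EuclideanSpace ℝ (Fin N)) : ‖r‖ ≤ ∑ i, |r i| := by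
  have h := EuclideanSpace.norm_sq_eq r
  refine abs_le_of_sq_le_sq' ?_ (Finset.sum_nonneg fun i _ => abs_nonneg _) |>.2
  rw [h]
  exact Finset.sum_sq_le_sq_sum_of_nonneg fun i _ => abs_nonneg _

theorem abs_coord_le_norm (r : EuclideanSpace ℝ (Fin N)) (i : Fin N) : |r i| ≤ ‖r‖ := by
  simpa using PiLp.norm_apply_le r i

/-- The quadratic form of a matrix is at most its Frobenius norm. -/
theorem sq_quadForm_le (A : Fin N → Fin N → ℝ) (r : EuclideanSpace ℝ (Fin N)) :
    (∑ i, ∑ j, A i j * (r i * r j)) ^ 2 ≤ (∑ i, ∑ j, A i j ^ 2) * (‖r‖ ^ 2) ^ 2 := by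
  have h := Finset.sum_mul_sq_le_sq_mul_sq Finset.univ (fun p : Fin N × Fin N => A p.1 p.2)
    (fun p => r p.1 * r p.2)
  rw [Fintype.sum_prod_type, Fintype.sum_prod_type, Fintype.sum_prod_type] at h
  refine h.trans_eq ?_
  congr 1
  rw [EuclideanSpace.norm_sq_eq, sq, Finset.sum_mul_sum]
  simp [mul_pow]

theorem abs_quadForm_le_sum_abs (A : Fin N → Fin N → ℝ) (r : EuclideanSpace ℝ (Fin N)) :
    |∑ i, ∑ j, A i j * (r i * r j)| ≤ (∑ i, ∑ j, |A i j|) * ‖r‖ ^ 2 := by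
  refine (Finset.abs_sum_le_sum_abs _ _).trans ?_
  rw [Finset.sum_mul]
  refine Finset.sum_le_sum fun i _ => (Finset.abs_sum_le_sum_abs _ _).trans ?_
  rw [Finset.sum_mul]
  refine Finset.sum_le_sum fun j _ => ?_
  rw [abs_mul, abs_mul, sq]
  gcongr <;> exact abs_coord_le_norm r _

theorem abs_inner_le_one {x y : EuclideanSpace ℝ (Fin n)} (hx : ‖x‖ = 1) (hy : ‖y‖ = 1) :
    |inner ℝ x y| ≤ 1 := by
  simpa [hx, hy] using abs_real_inner_le_norm x y

theorem abs_empGram_le_one (hm : 0 < m) {x : Fin N → EuclideanSpace ℝ (Fin n)}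
    (hx : ∀ i, ‖x i‖ = 1) (W : Matrix (Fin m) (Fin n) ℝ) (i j : Fin N) :
    |empGram x W i j| ≤ 1 := by
  have hm' : (0 : ℝ) < m := by exact_mod_cast hm
  unfold empGram
  rw [abs_mul, abs_of_pos (by positivity : 0 < 1 / (m : ℝ)), one_div, inv_mul_le_iff₀ hm', mul_one]
  refine (Finset.abs_sum_le_sum_abs _ _).trans ?_
  refine (Finset.sum_le_card_nsmul _ _ 1 fun k _ => ?_).trans_eq (by simp)
  rw [abs_mul, abs_mul, abs_of_nonneg (reluDeriv_nonneg _), abs_of_nonneg (reluDeriv_nonneg _)]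
  exact mul_le_one₀ (abs_inner_le_one (hx i) (hx j))
    (mul_nonneg (reluDeriv_nonneg _) (reluDeriv_nonneg _))
    (mul_le_one₀ (reluDeriv_le_one _) (reluDeriv_nonneg _) (reluDeriv_le_one _))

/-- Weights within row distance `R` of `W₀` have almost the same empirical Gram matrix. -/
theorem sum_abs_empGram_sub_le {x : Fin N → EuclideanSpace ℝ (Fin n)}
    (hx : ∀ i, ‖x i‖ = 1) {W W₀ : Matrix (Fin m) (Fin n) ℝ} {R : ℝ}
    (hW : ∀ k, ‖row W k - row W₀ k‖ ≤ R) :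
    ∑ i, ∑ j, |empGram x W i j - empGram x W₀ i j| ≤ 2 * N * unstableFrac x W₀ R := by
  have key : ∀ i j, |empGram x W i j - empGram x W₀ i j| ≤
      1 / (m : ℝ) * ∑ k, unstable W₀ R (x i) k + 1 / (m : ℝ) * ∑ k, unstable W₀ R (x j) k := by
    intro i j
    unfold empGram
    rw [← mul_sub, ← mul_add, ← Finset.sum_sub_distrib, ← Finset.sum_add_distrib, abs_mul,
      abs_of_nonneg (by positivity : 0 ≤ 1 / (m : ℝ))]
    refine mul_le_mul_of_nonneg_left ((Finset.abs_sum_le_sum_abs _ _).trans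
      (Finset.sum_le_sum fun k _ => ?_)) (by positivity)
    rw [← mul_sub, abs_mul]
    have h1 : |reluDeriv (inner ℝ (row W k) (x i)) - reluDeriv (inner ℝ (row W₀ k) (x i))| ≤
      unstable W₀ R (x i) k := abs_reluDeriv_sub_le (abs_inner_row_sub_le (hx i) (hW k))
    have h2 : |reluDeriv (inner ℝ (row W k) (x j)) - reluDeriv (inner ℝ (row W₀ k) (x j))| ≤
      unstable W₀ R (x j) k := abs_reluDeriv_sub_le (abs_inner_row_sub_le (hx j) (hW k))
    generalize reluDeriv (inner ℝ (row W k) (x i)) = p at *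
    have hq := reluDeriv_nonneg (inner ℝ (row W k) (x j))
    have hq1 := reluDeriv_le_one (inner ℝ (row W k) (x j))
    generalize reluDeriv (inner ℝ (row W k) (x j)) = q at *
    have hp := reluDeriv_nonneg (inner ℝ (row W₀ k) (x i))
    have hp1 := reluDeriv_le_one (inner ℝ (row W₀ k) (x i))
    generalize reluDeriv (inner ℝ (row W₀ k) (x i)) = p' at *
    generalize reluDeriv (inner ℝ (row W₀ k) (x j)) = q' at *
    have h3 : |p * q - p' * q'| ≤ |p - p'| + |q - q'| := by
      have e : p * q - p' * q' = (p - p') * q + p' * (q - q') := by ring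
      rw [e]
      refine (abs_add_le _ _).trans ?_
      rw [abs_mul, abs_mul, abs_of_nonneg hq, abs_of_nonneg hp]
      gcongr
      · exact mul_le_of_le_one_right (abs_nonneg _) hq1
      · exact mul_le_of_le_one_left (abs_nonneg _) hp1
    calc _ ≤ 1 * |p * q - p' * q'| := by
          gcongr
          exact abs_inner_le_one (hx i) (hx j)
      _ ≤ _ := by rw [one_mul]; linarith
  refine (Finset.sum_le_sum fun i _ => Finset.sum_le_sum fun j _ => key i j).trans_eq ?_
  simp only [Finset.sum_add_distrib, Finset.sum_const, Finset.card_univ, Fintype.card_fin,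
    nsmul_eq_mul, ← Finset.mul_sum, unstableFrac]
  ring

theorem row_lossGrad (hm : 0 < m) (x : Fin N → EuclideanSpace ℝ (Fin n))
    (y : EuclideanSpace ℝ (Fin N)) (a : Fin m → ℝ) (W : Matrix (Fin m) (Fin n) ℝ) (k : Fin m) :
    row (lossGrad x y a W) k = ∑ i, ((prediction x a W - y) i * a k *
      reluDeriv (inner ℝ (row W k) (x i)) * (1 / √(m : ℝ))) • x i := by
  ext j
  simp only [row, lossGrad, Matrix.of_apply, reluDeriv_preAct hm, prediction, WithLp.ofLp_sum,
    Finset.sum_apply, PiLp.smul_apply, PiLp.sub_apply, smul_eq_mul]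
  exact Finset.sum_congr rfl fun i _ => by ring

/-- The gradient with respect to each row is controlled by the residual, with the factor `1 / √m`
that makes training lazy. -/
theorem norm_row_lossGrad_le (hm : 0 < m) {x : Fin N → EuclideanSpace ℝ (Fin n)}
    (hx : ∀ i, ‖x i‖ = 1) (y : EuclideanSpace ℝ (Fin N)) {a : Fin m → ℝ}
    (ha : ∀ k, a k ^ 2 = 1) (W : Matrix (Fin m) (Fin n) ℝ) (k : Fin m) :
    ‖row (lossGrad x y a W) k‖ ≤ √N / √m * ‖prediction x a W - y‖ := by
  have hak : |a k| = 1 := (pow_eq_one_iff_of_nonneg (abs_nonneg _) two_ne_zero).1 (by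
    rw [sq_abs, ha])
  rw [row_lossGrad hm]
  refine (norm_sum_le _ _).trans ?_
  have h : ∀ i ∈ Finset.univ, ‖((prediction x a W - y) i * a k *
      reluDeriv (inner ℝ (row W k) (x i)) * (1 / √(m : ℝ))) • x i‖ ≤
      |(prediction x a W - y) i| * (1 / √(m : ℝ)) := by
    intro i _
    rw [norm_smul, hx, mul_one, Real.norm_eq_abs, abs_mul, abs_mul, abs_mul, hak, mul_one,
      abs_of_nonneg (reluDeriv_nonneg _), abs_of_nonneg (by positivity : 0 ≤ 1 / √(m : ℝ))]
    refine mul_le_mul_of_nonneg_right ?_ (by positivity)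
    exact mul_le_of_le_one_right (abs_nonneg _) (reluDeriv_le_one _)
  refine (Finset.sum_le_sum h).trans ?_
  rw [← Finset.sum_mul]
  refine (mul_le_mul_of_nonneg_right (sum_abs_le_sqrt_mul_norm _) (by positivity)).trans_eq ?_
  ring

theorem row_sub_smul (W G : Matrix (Fin m) (Fin n) ℝ) (η : ℝ) (k : Fin m) :
    row (W - η • G) k = row W k - η • row G k := by
  ext j; simp [row]

end

/-! ### Convergence of gradient descent -/

section

variable {m n N : ℕ}

/-- One gradient step acts on the residual as `1 - η G`, with `G` the empirical Gram matrix, up to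
an error that only the unstable neurons contribute to. -/
theorem abs_residual_step_sub_le (hm : 0 < m) {x : Fin N → EuclideanSpace ℝ (Fin n)}
    (hx : ∀ i, ‖x i‖ = 1) (y : EuclideanSpace ℝ (Fin N)) {a : Fin m → ℝ}
    (ha : ∀ k, a k ^ 2 = 1) {W W₀ : Matrix (Fin m) (Fin n) ℝ} {η R : ℝ} (hη : 0 ≤ η)
    (hW : ∀ k, ‖row W k - row W₀ k‖ ≤ R)
    (hW' : ∀ k, ‖row (W - η • lossGrad x y a W) k - row W₀ k‖ ≤ R) (i : Fin N) :
    |(prediction x a (W - η • lossGrad x y a W) - y) i - ((prediction x a W - y) i -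
      η * ∑ j, empGram x W i j * (prediction x a W - y) j)| ≤
      η * √N * ‖prediction x a W - y‖ * (1 / (m : ℝ) * ∑ k, unstable W₀ R (x i) k) := by
  have hm' : (0 : ℝ) < m := by exact_mod_cast hm
  have hsm : √(m : ℝ) * √(m : ℝ) = m := Real.mul_self_sqrt hm'.le
  have hs0 : 0 < √(m : ℝ) := Real.sqrt_pos.2 hm'
  set r := prediction x a W - y with hr
  set G := lossGrad x y a W with hG
  have hinc : ∀ k, inner ℝ (row (W - η • G) k) (x i) - inner ℝ (row W k) (x i) =
      -η * inner ℝ (row G k) (x i) := by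
    intro k
    rw [row_sub_smul, inner_sub_left, inner_smul_left]
    simp
  have hincb : ∀ k, |inner ℝ (row (W - η • G) k) (x i) - inner ℝ (row W k) (x i)| ≤
      η * (√N / √m * ‖r‖) := by
    intro k
    rw [hinc, abs_mul, abs_neg, abs_of_nonneg hη]
    refine mul_le_mul_of_nonneg_left ((abs_real_inner_le_norm _ _).trans ?_) hη
    rw [hx, mul_one]
    exact norm_row_lossGrad_le hm hx y ha W k
  -- the linearized change of the prediction; the factors `aₖ` cancel since `aₖ² = 1`
  have hlin : ∑ k, a k * (1 / √(m : ℝ) * (reluDeriv (inner ℝ (row W k) (x i)) *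
      (inner ℝ (row (W - η • G) k) (x i) - inner ℝ (row W k) (x i)))) =
      -(η * ∑ j, empGram x W i j * r j) := by
    have e : ∀ k, a k * (1 / √(m : ℝ) * (reluDeriv (inner ℝ (row W k) (x i)) *
      (inner ℝ (row (W - η • G) k) (x i) - inner ℝ (row W k) (x i)))) =
      -(η * ∑ j, 1 / (m : ℝ) * (inner ℝ (x i) (x j) * (reluDeriv (inner ℝ (row W k) (x i)) *
        reluDeriv (inner ℝ (row W k) (x j)))) * r j) := by
      intro k
      rw [hinc, hG, row_lossGrad hm, sum_inner, Finset.mul_sum, Finset.mul_sum, Finset.mul_sum,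
        Finset.mul_sum, Finset.mul_sum, ← Finset.sum_neg_distrib]
      refine Finset.sum_congr rfl fun j _ => ?_
      rw [inner_smul_left, real_inner_comm (x i) (x j), ← hr]
      have e2 : 1 / (m : ℝ) = 1 / √(m : ℝ) * (1 / √(m : ℝ)) * a k ^ 2 := by
        rw [ha, mul_one, div_mul_div_comm, one_mul, hsm]
      rw [e2]
      simp only [conj_trivial]
      ring
    rw [Finset.sum_congr rfl fun k _ => e k, Finset.sum_neg_distrib, ← Finset.mul_sum,
      Finset.sum_comm]
    simp only [empGram, Finset.mul_sum, Finset.sum_mul]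
  have hdiff : (prediction x a (W - η • G) - y) i - (r i - η * ∑ j, empGram x W i j * r j) =
      ∑ k, a k * (1 / √(m : ℝ) * (relu (inner ℝ (row (W - η • G) k) (x i)) -
        relu (inner ℝ (row W k) (x i)) - reluDeriv (inner ℝ (row W k) (x i)) *
        (inner ℝ (row (W - η • G) k) (x i) - inner ℝ (row W k) (x i)))) := by
    have h1 : ∀ V : Matrix (Fin m) (Fin n) ℝ, (prediction x a V - y) i =
        ∑ k, a k * (1 / √(m : ℝ) * relu (inner ℝ (row V k) (x i))) - y i := by
      intro V
      simp only [prediction, network, PiLp.sub_apply]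
      congr 1
      refine Finset.sum_congr rfl fun k _ => ?_
      rw [preAct_apply, relu_mul_of_nonneg (by positivity)]
    simp only [mul_sub, Finset.sum_sub_distrib] at hlin ⊢
    rw [h1, hr, h1, ← hr]
    linarith
  rw [hdiff]
  refine (Finset.abs_sum_le_sum_abs _ _).trans ?_
  have hb : ∀ k ∈ Finset.univ, |a k * (1 / √(m : ℝ) *
      (relu (inner ℝ (row (W - η • G) k) (x i)) -
        relu (inner ℝ (row W k) (x i)) - reluDeriv (inner ℝ (row W k) (x i)) *
        (inner ℝ (row (W - η • G) k) (x i) - inner ℝ (row W k) (x i))))| ≤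
      η * √N * ‖r‖ * (1 / (m : ℝ)) * unstable W₀ R (x i) k := by
    intro k _
    have hak : |a k| = 1 := (pow_eq_one_iff_of_nonneg (abs_nonneg _) two_ne_zero).1 (by
      rw [sq_abs, ha])
    have h1 := abs_relu_sub_le (abs_inner_row_sub_le (hx i) (hW k))
      (abs_inner_row_sub_le (hx i) (hW' k))
    have h2 := h1.trans (mul_le_mul_of_nonneg_left (hincb k) (unstable_nonneg W₀ R (x i) k))
    rw [abs_mul, abs_mul, hak, one_mul, abs_of_pos (by positivity : 0 < 1 / √(m : ℝ))]
    refine (mul_le_mul_of_nonneg_left h2 (by positivity)).trans_eq ?_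
    have e : 1 / (m : ℝ) = 1 / √(m : ℝ) * (1 / √(m : ℝ)) := by
      rw [div_mul_div_comm, one_mul, hsm]
    rw [e, unstable]
    ring
  refine (Finset.sum_le_sum hb).trans_eq ?_
  rw [← Finset.mul_sum]
  ring

/-- If `G` is bounded below by `μ` as a quadratic form, with entries at most `1`, then a step
`r ↦ r - η G r` contracts. -/
theorem norm_sub_smul_le {G : Fin N → Fin N → ℝ} (hG : ∀ i j, |G i j| ≤ 1) {μ η : ℝ}
    (r : EuclideanSpace ℝ (Fin N)) (hη : 0 ≤ η)
    (hlow : μ / 2 * ‖r‖ ^ 2 ≤ ∑ i, ∑ j, G i j * (r i * r j))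
    (hηN : η * (N : ℝ) ^ 2 ≤ μ / 4) (hημ : η * μ ≤ 1) :
    ‖r - η • (WithLp.toLp 2 fun i => ∑ j, G i j * r j : EuclideanSpace ℝ (Fin N))‖ ≤
      (1 - 3 / 8 * (η * μ)) * ‖r‖ := by
  set g : EuclideanSpace ℝ (Fin N) := WithLp.toLp 2 fun i => ∑ j, G i j * r j with hg
  have h1 : inner ℝ r g = ∑ i, ∑ j, G i j * (r i * r j) := by
    rw [PiLp.inner_apply]
    refine Finset.sum_congr rfl fun i _ => ?_
    rw [hg]
    simp only [RCLike.inner_apply, conj_trivial]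
    rw [Finset.sum_mul]
    exact Finset.sum_congr rfl fun j _ => by ring
  have h2 : ‖g‖ ^ 2 ≤ (N : ℝ) ^ 2 * ‖r‖ ^ 2 := by
    have hi : ∀ i, ‖g i‖ ^ 2 ≤ N * ‖r‖ ^ 2 := by
      intro i
      have := Finset.sum_mul_sq_le_sq_mul_sq Finset.univ (fun j => G i j) (fun j => r j)
      rw [Real.norm_eq_abs, sq_abs, EuclideanSpace.norm_sq_eq]
      refine this.trans ?_
      simp only [Real.norm_eq_abs, sq_abs]
      refine mul_le_mul_of_nonneg_right ?_ (Finset.sum_nonneg fun _ _ => sq_nonneg _)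
      refine (Finset.sum_le_card_nsmul _ _ 1 fun j _ => ?_).trans_eq (by simp)
      exact (sq_le_one_iff_abs_le_one _).2 (hG i j)
    rw [EuclideanSpace.norm_sq_eq]
    refine (Finset.sum_le_card_nsmul _ _ _ fun i _ => hi i).trans_eq ?_
    simp
    ring
  refine abs_le_of_sq_le_sq' ?_ (mul_nonneg (by linarith) (norm_nonneg _)) |>.2
  rw [norm_sub_sq_real, norm_smul, inner_smul_right, h1, mul_pow, mul_pow, Real.norm_eq_abs, sq_abs]
  have h3 : η ^ 2 * ‖g‖ ^ 2 ≤ η * (μ / 4) * ‖r‖ ^ 2 := by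
    calc η ^ 2 * ‖g‖ ^ 2 ≤ η ^ 2 * ((N : ℝ) ^ 2 * ‖r‖ ^ 2) := by gcongr
      _ = η * (η * (N : ℝ) ^ 2) * ‖r‖ ^ 2 := by ring
      _ ≤ _ := by gcongr
  have h4 := mul_le_mul_of_nonneg_left hlow hη
  nlinarith [mul_nonneg (sq_nonneg (η * μ)) (sq_nonneg ‖r‖)]

/-- **Linear convergence near the initialization.** The residual decays geometrically, and the
rows of the weight matrix stay within distance `4 √N ‖u(0) - y‖ / (√m μ)` of their initial values.
The two claims are proved by one induction: the second one at step `l` keeps most neurons stable,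
which gives the first one at step `l`, which bounds the next gradient. -/
theorem gradDescent_invariant (hm : 0 < m) {x : Fin N → EuclideanSpace ℝ (Fin n)}
    (hx : ∀ i, ‖x i‖ = 1) (y : EuclideanSpace ℝ (Fin N)) {a : Fin m → ℝ}
    (ha : ∀ k, a k ^ 2 = 1) {W₀ : Matrix (Fin m) (Fin n) ℝ} {η R μ : ℝ} (hη : 0 ≤ η)
    (hμ : 0 < μ) (hμ1 : μ ≤ 1) (hN : 0 < N) (hηN : η * (N : ℝ) ^ 2 ≤ μ / 4)
    (hgram : ∀ r : EuclideanSpace ℝ (Fin N),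
      3 / 4 * μ * ‖r‖ ^ 2 ≤ ∑ i, ∑ j, empGram x W₀ i j * (r i * r j))
    (hstab : unstableFrac x W₀ R ≤ μ / (8 * N))
    (hR : 4 * √N * ‖prediction x a W₀ - y‖ / (√m * μ) ≤ R) (l : ℕ) :
    ‖prediction x a (gradDescent x y a η W₀ l) - y‖ ≤
        (1 - η * μ / 4) ^ l * ‖prediction x a W₀ - y‖ ∧
      ∀ k, ‖row (gradDescent x y a η W₀ l) k - row W₀ k‖ ≤
        4 * √N * ‖prediction x a W₀ - y‖ / (√m * μ) * (1 - (1 - η * μ / 4) ^ l) := by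
  have hm' : (0 : ℝ) < m := by exact_mod_cast hm
  have hs0 : 0 < √(m : ℝ) := Real.sqrt_pos.2 hm'
  have hN1 : (1 : ℝ) ≤ N := by exact_mod_cast hN
  have hη4 : η ≤ 1 / 4 := by
    have := mul_le_mul_of_nonneg_left (one_le_pow₀ hN1 : (1 : ℝ) ≤ (N : ℝ) ^ 2) hη
    linarith
  have hημ : η * μ ≤ 1 := by nlinarith
  set r₀ := ‖prediction x a W₀ - y‖ with hr₀
  set D := 4 * √N * r₀ / (√m * μ) with hD
  set q := 1 - η * μ / 4 with hq
  have hq0 : 0 ≤ q := by rw [hq]; linarith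
  have hq1 : q ≤ 1 := by rw [hq]; nlinarith
  have hD0 : 0 ≤ D := by positivity
  have hDle : ∀ l, D * (1 - q ^ l) ≤ R := fun l =>
    (mul_le_of_le_one_right hD0 (by linarith [pow_nonneg hq0 l])).trans hR
  induction l with
  | zero => simp [gradDescent, hr₀]
  | succ l ih =>
    obtain ⟨ih1, ih2⟩ := ih
    set W := gradDescent x y a η W₀ l with hW
    have hstep : gradDescent x y a η W₀ (l + 1) = W - η • lossGrad x y a W := rfl
    rw [hstep]
    set r := prediction x a W - y with hr
    have hrow : ∀ k, ‖row (W - η • lossGrad x y a W) k - row W₀ k‖ ≤ D * (1 - q ^ (l + 1)) := by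
      intro k
      rw [row_sub_smul, sub_right_comm]
      refine (norm_sub_le _ _).trans ?_
      rw [norm_smul, Real.norm_eq_abs, abs_of_nonneg hη]
      have h1 := norm_row_lossGrad_le hm hx y ha W k
      have h2 : √N / √m * ‖r‖ ≤ √N / √m * (q ^ l * r₀) := by gcongr
      have h3 : η * (√N / √m * (q ^ l * r₀)) = D * (q ^ l * (1 - q)) := by
        rw [hD, hq]; field_simp; ring
      have h4 := mul_le_mul_of_nonneg_left (h1.trans h2) hη
      rw [h3] at h4
      have h5 := ih2 k
      rw [pow_succ]
      linarith
    refine ⟨?_, hrow⟩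
    have hWR : ∀ k, ‖row W k - row W₀ k‖ ≤ R := fun k => (ih2 k).trans (hDle l)
    have hWR' : ∀ k, ‖row (W - η • lossGrad x y a W) k - row W₀ k‖ ≤ R := fun k =>
      (hrow k).trans (hDle (l + 1))
    have hs := unstableFrac_nonneg x W₀ R
    have hNs : N * unstableFrac x W₀ R ≤ μ / 8 := by
      rw [le_div_iff₀ (by positivity)] at hstab
      linarith
    -- few unstable neurons: the empirical Gram matrix is still coercive
    have hlow : μ / 2 * ‖r‖ ^ 2 ≤ ∑ i, ∑ j, empGram x W i j * (r i * r j) := by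
      have h1 := hgram r
      have h2 := abs_quadForm_le_sum_abs (fun i j => empGram x W i j - empGram x W₀ i j) r
      have h3 := sum_abs_empGram_sub_le hx hWR
      simp only [sub_mul, Finset.sum_sub_distrib] at h2
      have h4 := (abs_le.1 h2).1
      have h5 : (∑ i, ∑ j, |empGram x W i j - empGram x W₀ i j|) * ‖r‖ ^ 2 ≤
          μ / 4 * ‖r‖ ^ 2 := mul_le_mul_of_nonneg_right (by linarith) (sq_nonneg _)
      linarith
    have hcon := norm_sub_smul_le (abs_empGram_le_one hm hx W) r hη hlow hηN hημ
    set g : EuclideanSpace ℝ (Fin N) :=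
      r - η • (WithLp.toLp 2 fun i => ∑ j, empGram x W i j * r j) with hg
    set r' := prediction x a (W - η • lossGrad x y a W) - y with hr'
    have herr : ‖r' - g‖ ≤ η * √N * ‖r‖ * unstableFrac x W₀ R := by
      refine (norm_le_sum_abs _).trans ?_
      rw [unstableFrac, Finset.mul_sum]
      exact Finset.sum_le_sum fun i _ => abs_residual_step_sub_le hm hx y ha hη hWR hWR' i
    have hsqrt : √(N : ℝ) * unstableFrac x W₀ R ≤ μ / 8 := by
      refine (mul_le_mul_of_nonneg_right ?_ hs).trans hNs
      exact Real.sqrt_le_iff.2 ⟨by linarith, by nlinarith⟩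
    have herr' : ‖r' - g‖ ≤ η * μ / 8 * ‖r‖ := by
      refine herr.trans ?_
      have := mul_le_mul_of_nonneg_left hsqrt (mul_nonneg hη (norm_nonneg r))
      linarith
    have htri : ‖r'‖ ≤ ‖g‖ + ‖r' - g‖ := by
      simpa using norm_add_le g (r' - g)
    calc ‖r'‖ ≤ q * ‖r‖ := by rw [hq]; linarith
      _ ≤ q * (q ^ l * r₀) := by gcongr
      _ = q ^ (l + 1) * r₀ := by ring

/-- Rows within distance `D` give hidden layers that differ by at most `D` in operator norm. -/
theorem norm_preAct_sub_le (hm : 0 < m) {W W₀ : Matrix (Fin m) (Fin n) ℝ} {D : ℝ} (hD : 0 ≤ D)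
    (hW : ∀ k, ‖row W k - row W₀ k‖ ≤ D) (v : EuclideanSpace ℝ (Fin n)) :
    ‖preAct W v - preAct W₀ v‖ ≤ D * ‖v‖ := by
  have hm' : (0 : ℝ) < m := by exact_mod_cast hm
  refine abs_le_of_sq_le_sq' ?_ (by positivity) |>.2
  rw [EuclideanSpace.norm_sq_eq]
  have h : ∀ k ∈ Finset.univ, ‖(preAct W v - preAct W₀ v) k‖ ^ 2 ≤ 1 / (m : ℝ) * (D * ‖v‖) ^ 2 := by
    intro k _
    rw [PiLp.sub_apply, preAct_apply, preAct_apply, ← mul_sub, ← inner_sub_left, norm_mul, mul_pow]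
    have e : ‖1 / √(m : ℝ)‖ ^ 2 = 1 / m := by
      rw [Real.norm_eq_abs, sq_abs, div_pow, Real.sq_sqrt hm'.le, one_pow]
    rw [e]
    gcongr
    exact (norm_inner_le_norm _ _).trans (mul_le_mul_of_nonneg_right (hW k) (norm_nonneg _))
  refine (Finset.sum_le_card_nsmul _ _ _ h).trans_eq ?_
  simp
  field_simp

end

/-! ### The neurons at random initialization -/

section

/-- Grouping: disjoint blocks of a countable independent family are independent. -/
theorem iIndepFun_blocks {Ω ι : Type*} [Countable ι] {κ : ι → Type*} [∀ i, Countable (κ i)]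
    [MeasurableSpace Ω] {P : Measure Ω}
    {X : (i : ι) → κ i → Ω → ℝ} (mX : ∀ i j, AEMeasurable (X i j) P)
    (h : iIndepFun (fun (p : (i : ι) × κ i) => X p.1 p.2) P) :
    iIndepFun (fun i ω => fun j => X i j ω) P := by
  have := h.isProbabilityMeasure
  have hp : ∀ i j, IsProbabilityMeasure (P.map (X i j)) :=
    fun i j ↦ Measure.isProbabilityMeasure_map (mX i j)
  have hblock : ∀ i, AEMeasurable (fun ω j => X i j ω) P := fun i => aemeasurable_pi_lambda _ (mX i)
  rw [iIndepFun_iff_map_fun_eq_infinitePi_map₀' hblock]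
  have h1 : ∀ i, P.map (fun ω j => X i j ω) = Measure.infinitePi fun j => P.map (X i j) := fun i =>
    (iIndepFun_iff_map_fun_eq_infinitePi_map₀' (mX i)).1
      (h.precomp (g := fun j : κ i => (⟨i, j⟩ : (i : ι) × κ i)) sigma_mk_injective)
  simp_rw [h1]
  rw [← Measure.infinitePi_map_piCurry (fun i j => P.map (X i j)),
    ← (iIndepFun_iff_map_fun_eq_infinitePi_map₀' (fun p : (i : ι) × κ i => mX p.1 p.2)).1 h,
    AEMeasurable.map_map_of_aemeasurable]
  · rfl
  · exact (MeasurableEquiv.measurable _).aemeasurable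
  · exact aemeasurable_pi_lambda _ fun p => mX p.1 p.2

variable {m n N : ℕ} {Ω : Type*} [MeasurableSpace Ω] {P : Measure Ω}
  {W₀ : Ω → Matrix (Fin m) (Fin n) ℝ} {a : Ω → Fin m → ℝ}

namespace IsRandomInit

/-- The neurons, consisting of a row of `W₀` and an entry of `a` each, are independent. -/
theorem iIndepFun_neuron (h : IsRandomInit P W₀ a) :
    iIndepFun (fun k ω => ((fun j => W₀ ω k j, a ω k) : (Fin n → ℝ) × ℝ)) P := by
  let X : (k : Fin m) → Option (Fin n) → Ω → ℝ := fun k o ω => o.elim (a ω k) fun j => W₀ ω k j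
  have mX : ∀ k o, AEMeasurable (X k o) P := by
    rintro k (_ | j)
    · exact (h.law_a k).aemeasurable
    · exact (h.law_W k j).aemeasurable
  let g : (Σ _ : Fin m, Option (Fin n)) → (Fin m × Fin n) ⊕ Fin m := fun p =>
    p.2.elim (Sum.inr p.1) fun j => Sum.inl (p.1, j)
  have hg : Function.Injective g := by
    rintro ⟨k, _ | j⟩ ⟨k', _ | j'⟩ hh <;> simp_all [g]
  have hX : iIndepFun (fun p : Σ _ : Fin m, Option (Fin n) => X p.1 p.2) P := by
    have := h.indep.precomp hg
    convert this using 1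
    funext p
    rcases p with ⟨k, _ | j⟩ <;> rfl
  have hb := iIndepFun_blocks mX hX
  exact hb.comp (fun _ z => (fun j => z (some j), z none)) fun _ => by fun_prop

theorem aemeasurable_row (h : IsRandomInit P W₀ a) (k : Fin m) :
    AEMeasurable (fun ω => (W₀ ω k : Fin n → ℝ)) P :=
  aemeasurable_pi_lambda _ fun j => (h.law_W k j).aemeasurable

theorem iIndepFun_row (h : IsRandomInit P W₀ a) (k : Fin m) :
    iIndepFun (fun j ω => W₀ ω k j) P :=
  h.indep.precomp (g := fun j => Sum.inl (k, j)) fun _ _ hh => by simpa using hh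

theorem hasLaw_row (h : IsRandomInit P W₀ a) (k : Fin m) :
    HasLaw (fun ω => (fun j => W₀ ω k j)) (Measure.pi fun _ : Fin n => gaussianReal 0 1) P :=
  iIndepFun.hasLaw_pi (fun j => h.law_W k j) (h.iIndepFun_row k)

/-- The pre-activation of a neuron at a unit vector is standard normal. -/
theorem hasLaw_inner_row (h : IsRandomInit P W₀ a) {v : EuclideanSpace ℝ (Fin n)} (hv : ‖v‖ = 1)
    (k : Fin m) : HasLaw (fun ω => inner ℝ (row (W₀ ω) k) v) (gaussianReal 0 1) P := by
  have := h.indep.isProbabilityMeasure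
  have hlaw : ∀ j, HasLaw (fun ω => v j * W₀ ω k j) 
      (gaussianReal (v j * 0) (NNReal.mk (v j ^ 2) (sq_nonneg _) * 1)) P :=
    fun j => gaussianReal_const_mul (h.law_W k j) (v j)
  have hind : iIndepFun (fun j ω => v j * W₀ ω k j) P :=
    (h.iIndepFun_row k).comp (fun j z => v j * z) fun _ => by fun_prop
  have hG : HasGaussianLaw (fun ω => ∑ j, v j * W₀ ω k j) P :=
    iIndepFun.hasGaussianLaw_fun_sum (fun j => (hlaw j).hasGaussianLaw) hind
  have e : (fun ω => inner ℝ (row (W₀ ω) k) v) = fun ω => ∑ j, v j * W₀ ω k j := by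
    funext ω
    simp [row, PiLp.inner_apply]
  rw [e]
  have hL2 : ∀ j, MemLp (fun ω => v j * W₀ ω k j) 2 P := fun j =>
    ((hlaw j).hasGaussianLaw).memLp_two
  have hmean : P[fun ω => ∑ j, v j * W₀ ω k j] = 0 := by
    rw [integral_finsetSum _ fun j _ => (hL2 j).integrable (by norm_num)]
    refine Finset.sum_eq_zero fun j _ => ?_
    rw [(hlaw j).integral_eq, integral_id_gaussianReal, mul_zero]
  have hvar : Var[fun ω => ∑ j, v j * W₀ ω k j; P] = 1 := by
    have := IndepFun.variance_sum (s := Finset.univ) (fun j _ => hL2 j)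
      (fun i _ j _ hij => hind.indepFun hij)
    have e : (∑ j, fun ω => v j * W₀ ω k j) = fun ω => ∑ j, v j * W₀ ω k j := by
      ext; simp
    rw [e] at this
    rw [this]
    have hv2 : ∑ j, v j ^ 2 = 1 := by
      have := EuclideanSpace.norm_sq_eq v
      simpa [hv] using this.symm
    rw [← hv2]
    refine Finset.sum_congr rfl fun j _ => ?_
    rw [(hlaw j).variance_eq, variance_id_gaussianReal, mul_one]
    rfl
  refine ⟨hG.aemeasurable, ?_⟩
  rw [hG.map_eq_gaussianReal, hmean, hvar, Real.toNNReal_one]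

theorem ae_sq_eq_one (h : IsRandomInit P W₀ a) : ∀ᵐ ω ∂P, ∀ k, a ω k ^ 2 = 1 := by
  rw [ae_all_iff]
  intro k
  have hae : ∀ᵐ z ∂(uniformOn ({-1, 1} : Set ℝ)), z ^ 2 = 1 := by
    have hs : MeasurableSet ({-1, 1} : Set ℝ) := (Set.toFinite _).measurableSet
    refine ae_cond_of_forall_mem hs ?_
    rintro z (rfl | rfl) <;> norm_num
  exact ((h.law_a k).ae_iff (p := fun z => z ^ 2 = 1) (by fun_prop)).2 hae

theorem integral_sign (h : IsRandomInit P W₀ a) (k : Fin m) : ∫ ω, a ω k ∂P = 0 := by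
  rw [(h.law_a k).integral_eq, uniformOn, ProbabilityTheory.cond, integral_smul_measure]
  have e : ({-1, 1} : Set ℝ) = (({-1, 1} : Finset ℝ) : Set ℝ) := by simp
  rw [e, setIntegral_finset]
  · rw [Finset.sum_pair (by norm_num)]
    simp [Measure.real]
  · have hfin : IsFiniteMeasure
        ((Measure.count : Measure ℝ).restrict (({-1, 1} : Finset ℝ) : Set ℝ)) :=
      ⟨by
        rw [Measure.restrict_apply_univ]
        exact Measure.count_apply_lt_top.2 (Finset.finite_toSet _)⟩
    refine Integrable.of_bound (by fun_prop) 1 ?_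
    refine (ae_restrict_iff' (Finset.measurableSet _)).2 (ae_of_all _ fun z hz => ?_)
    have hz' : z = -1 ∨ z = 1 := by simpa using hz
    rcases hz' with rfl | rfl <;> norm_num

end IsRandomInit

end

/-! ### Chi-square concentration and the Johnson–Lindenstrauss property -/

section

section ChiSquare

/-- The exponential inequality that turns the Chernoff bound for the chi-square distribution into
the exponent `(s² - |s|³) / 4`. -/
theorem one_add_le_exp {s : ℝ} (h1 : -1 < s) (h2 : s < 1) :
    1 + s ≤ Real.exp (s - (s ^ 2 - |s| ^ 3) / 2) := by
  rcases le_total 0 s with hs | hs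
  · rw [abs_of_nonneg hs]
    have hz : 0 ≤ s - (s ^ 2 - s ^ 3) / 2 := by nlinarith [pow_nonneg hs 3]
    refine le_trans ?_ (Real.quadratic_le_exp_of_nonneg hz)
    have h3 : s * (1 - s / 2) ≤ s - (s ^ 2 - s ^ 3) / 2 := by nlinarith [pow_nonneg hs 3]
    have h4 : 0 ≤ s * (1 - s / 2) := mul_nonneg hs (by linarith)
    nlinarith [pow_le_pow_left₀ h4 h3 2, pow_nonneg hs 4]
  · rw [abs_of_nonpos hs]
    have h3 := Real.hasSum_pow_div_log_of_abs_lt_one (x := -s)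
      (by rw [abs_lt]; constructor <;> linarith)
    have h4 := sum_le_hasSum (Finset.range 2)
      (fun n _ => div_nonneg (pow_nonneg (by linarith : 0 ≤ -s) _) (by positivity)) h3
    simp only [Finset.sum_range_succ, Finset.sum_range_zero] at h4
    norm_num at h4
    rw [← Real.log_le_iff_le_exp (by linarith)]
    nlinarith [pow_nonneg (by linarith : 0 ≤ -s) 3]

/-- The moment generating function of the chi-square distribution with one degree of freedom. -/
theorem integral_exp_sq_gaussianReal {t : ℝ} (ht : t < 1 / 2) :
    ∫ z, Real.exp (t * z ^ 2) ∂(gaussianReal 0 1) = (√(1 - 2 * t))⁻¹ := by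
  rw [integral_gaussianReal_eq_integral_smul one_ne_zero, gaussianPDFReal_def]
  have e : ∀ z : ℝ, ((√(2 * Real.pi * (1 : NNReal)))⁻¹ *
      Real.exp (-(z - 0) ^ 2 / (2 * (1 : NNReal)))) • Real.exp (t * z ^ 2) =
      (√(2 * Real.pi))⁻¹ * Real.exp (-(1 / 2 - t) * z ^ 2) := by
    intro z
    rw [smul_eq_mul, mul_assoc, ← Real.exp_add]
    simp only [NNReal.coe_one, mul_one, sub_zero]
    congr 2
    ring
  simp_rw [e]
  have hb : 0 < 1 - 2 * t := by linarith
  rw [integral_const_mul, integral_gaussian, ← Real.sqrt_inv, ← Real.sqrt_inv,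
    ← Real.sqrt_mul (by positivity)]
  congr 1
  have hb' : 1 / 2 - t ≠ 0 := by linarith
  field_simp

variable {Ω : Type*} [MeasurableSpace Ω] {P : Measure Ω} {m : ℕ} {g : Fin m → Ω → ℝ}

theorem mgf_sum_sq (hg : ∀ k, HasLaw (g k) (gaussianReal 0 1) P) (hind : iIndepFun g P) {t : ℝ}
    (ht : t < 1 / 2) : mgf (∑ k, fun ω => g k ω ^ 2) P t = (√(1 - 2 * t))⁻¹ ^ m := by
  have hind2 : iIndepFun (fun k ω => g k ω ^ 2) P :=
    hind.comp (fun _ z => z ^ 2) fun _ => by fun_prop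
  rw [hind2.mgf_sum₀ (fun k => (hg k).aemeasurable.pow_const 2)]
  have h1 : ∀ k, mgf (fun ω => g k ω ^ 2) P t = (√(1 - 2 * t))⁻¹ := by
    intro k
    rw [← integral_exp_sq_gaussianReal ht]
    exact (hg k).integral_comp (f := fun z => Real.exp (t * z ^ 2)) (by fun_prop)
  simp [h1]

/-- The Chernoff bound at the parameter `t = s / (2 (1 + s))`, for which `1 - 2t = 1 / (1 + s)`. -/
theorem exp_mul_inv_sqrt_pow_le {s : ℝ} (h1 : -1 < s) (h2 : s < 1) :
    Real.exp (-(s / (2 * (1 + s))) * (m * (1 + s))) * (√(1 - 2 * (s / (2 * (1 + s)))))⁻¹ ^ m ≤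
      Real.exp (-(m / 4 * (s ^ 2 - |s| ^ 3))) := by
  have hs : 0 < 1 + s := by linarith
  have e1 : 1 - 2 * (s / (2 * (1 + s))) = (1 + s)⁻¹ := by field_simp; ring
  have e2 : -(s / (2 * (1 + s))) * (m * (1 + s)) = m * (-s / 2) := by field_simp
  have e3 : -((m : ℝ) / 4 * (s ^ 2 - |s| ^ 3)) = m * (-(s ^ 2 - |s| ^ 3) / 4) := by ring
  rw [e1, Real.sqrt_inv, inv_inv, e2, e3, Real.exp_nat_mul, Real.exp_nat_mul, ← mul_pow]
  refine pow_le_pow_left₀ (by positivity) ?_ m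
  have h3 : √(1 + s) ≤ Real.exp (s / 2 - (s ^ 2 - |s| ^ 3) / 4) := by
    rw [Real.sqrt_le_left (Real.exp_pos _).le, ← Real.exp_nat_mul]
    refine (one_add_le_exp h1 h2).trans_eq ?_
    congr 1
    push_cast
    ring
  calc _ ≤ Real.exp (-s / 2) * Real.exp (s / 2 - (s ^ 2 - |s| ^ 3) / 4) := by gcongr
    _ = _ := by rw [← Real.exp_add]; congr 1; ring

/-- Concentration of the chi-square distribution with `m` degrees of freedom, by the Chernoff bound
with the optimal parameter `s / (2 (1 + s))` for `s = τ` and for `s = -τ`. -/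
theorem measureReal_sum_sq_not_mem_le [IsProbabilityMeasure P]
    (hg : ∀ k, HasLaw (g k) (gaussianReal 0 1) P)
    (hind : iIndepFun g P) {τ : ℝ} (h0 : 0 < τ) (h1 : τ < 1) :
    P.real {ω | ¬((1 - τ) * m ≤ ∑ k, g k ω ^ 2 ∧ ∑ k, g k ω ^ 2 ≤ (1 + τ) * m)} ≤
      2 * Real.exp (-(m / 4 * (τ ^ 2 - τ ^ 3))) := by
  have e : ∀ ω, (∑ k, fun ω => g k ω ^ 2) ω = ∑ k, g k ω ^ 2 := fun ω => by simp
  -- a function with nonzero Bochner integral is integrable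
  have hint : ∀ t : ℝ, t < 1 / 2 →
      Integrable (fun ω => Real.exp (t * (∑ k, fun ω => g k ω ^ 2) ω)) P := by
    intro t ht
    by_contra h
    have h2 := mgf_sum_sq hg hind ht
    rw [mgf, integral_undef h] at h2
    have h3 : 0 < √(1 - 2 * t) := Real.sqrt_pos.2 (by linarith)
    have : 0 < (√(1 - 2 * t))⁻¹ ^ m := by positivity
    linarith
  have hlt : ∀ s : ℝ, -1 < s → s / (2 * (1 + s)) < 1 / 2 := by
    intro s hs
    have : 0 < 1 + s := by linarith
    rw [div_lt_div_iff₀ (by positivity) (by norm_num)]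
    linarith
  have hup := measure_ge_le_exp_mul_mgf (μ := P) (t := τ / (2 * (1 + τ))) (m * (1 + τ))
    (by positivity) (hint _ (hlt τ (by linarith)))
  have hlo := measure_le_le_exp_mul_mgf (μ := P) (t := -τ / (2 * (1 + -τ))) (m * (1 + -τ))
    (div_nonpos_of_nonpos_of_nonneg (by linarith) (by linarith)) (hint _ (hlt (-τ) (by linarith)))
  rw [mgf_sum_sq hg hind (hlt _ (by linarith))] at hup hlo
  have hup' := hup.trans (exp_mul_inv_sqrt_pow_le (by linarith) h1)
  have hlo' := hlo.trans (exp_mul_inv_sqrt_pow_le (by linarith) (by linarith))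
  rw [abs_of_pos h0] at hup'
  rw [abs_neg, abs_of_pos h0, neg_sq] at hlo'
  have hsub : {ω | ¬((1 - τ) * m ≤ ∑ k, g k ω ^ 2 ∧ ∑ k, g k ω ^ 2 ≤ (1 + τ) * m)} ⊆
      {ω | m * (1 + τ) ≤ (∑ k, fun ω => g k ω ^ 2) ω} ∪
      {ω | (∑ k, fun ω => g k ω ^ 2) ω ≤ m * (1 + -τ)} := by
    intro ω hω
    simp only [Set.mem_ofPred_eq, Set.mem_union, e, not_and_or, not_le] at hω ⊢
    rcases hω with h | h
    · right; linarith
    · left; linarith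
  calc _ ≤ _ := measureReal_mono hsub
    _ ≤ _ := measureReal_union_le _ _
    _ ≤ _ := by linarith

end ChiSquare

/-- The union bound over unordered pairs. -/
theorem measureReal_exists_pair_le {Ω α : Type*} [MeasurableSpace Ω] {P : Measure Ω}
    [IsFiniteMeasure P] [DecidableEq α] {B : α → α → Set Ω} (hB : ∀ x y, B x y = B y x) {p : ℝ}
    (hp : ∀ x y, x ≠ y → P.real (B x y) ≤ 2 * p) (X : Finset α) :
    P.real {ω | ∃ x ∈ X, ∃ y ∈ X, x ≠ y ∧ ω ∈ B x y} ≤ (X.card : ℝ) * ((X.card : ℝ) - 1) * p := by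
  induction X using Finset.induction_on with
  | empty => simp
  | insert z X hz ih =>
    have hsub : {ω | ∃ x ∈ insert z X, ∃ y ∈ insert z X, x ≠ y ∧ ω ∈ B x y} ⊆
        {ω | ∃ x ∈ X, ∃ y ∈ X, x ≠ y ∧ ω ∈ B x y} ∪ ⋃ y ∈ X, B z y := by
      rintro ω ⟨x, hx, y, hy, hxy, hω⟩
      rcases Finset.mem_insert.1 hx with hx' | hx' <;> rcases Finset.mem_insert.1 hy with hy' | hy'
      · exact absurd (hx'.trans hy'.symm) hxy
      · exact Or.inr (Set.mem_biUnion (Finset.mem_coe.2 hy') (hx' ▸ hω))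
      · exact Or.inr (Set.mem_biUnion (Finset.mem_coe.2 hx') (hy' ▸ hB x y ▸ hω))
      · exact Or.inl ⟨x, hx', y, hy', hxy, hω⟩
    have h1 : P.real (⋃ y ∈ X, B z y) ≤ X.card * (2 * p) := by
      refine (measureReal_biUnion_finset_le X fun y => B z y).trans ?_
      refine (Finset.sum_le_card_nsmul _ _ _ fun y hy => hp z y ?_).trans_eq (by simp)
      rintro rfl
      exact hz hy
    rw [Finset.card_insert_of_notMem hz]
    push_cast
    calc _ ≤ _ := measureReal_mono hsub
      _ ≤ _ := measureReal_union_le _ _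
      _ ≤ _ := by linarith

variable {m n : ℕ} {Ω : Type*} [MeasurableSpace Ω] {P : Measure Ω}
  {W₀ : Ω → Matrix (Fin m) (Fin n) ℝ} {a : Ω → Fin m → ℝ}

theorem norm_preAct_sq (W : Matrix (Fin m) (Fin n) ℝ)
    (v : EuclideanSpace ℝ (Fin n)) :
    ‖preAct W v‖ ^ 2 = 1 / (m : ℝ) * ∑ k, inner ℝ (row W k) v ^ 2 := by
  rw [EuclideanSpace.norm_sq_eq, Finset.mul_sum]
  refine Finset.sum_congr rfl fun k _ => ?_
  rw [preAct_apply, Real.norm_eq_abs, sq_abs, mul_pow, div_pow, Real.sq_sqrt (Nat.cast_nonneg m),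
    one_pow]

theorem IsRandomInit.iIndepFun_inner_row (h : IsRandomInit P W₀ a)
    (v : EuclideanSpace ℝ (Fin n)) : iIndepFun (fun k ω => inner ℝ (row (W₀ ω) k) v) P :=
  h.iIndepFun_neuron.comp
    (fun _ z => inner ℝ (WithLp.toLp 2 z.1 : EuclideanSpace ℝ (Fin n)) v) fun _ => by fun_prop

/-- The random hidden layer almost preserves the norm of a fixed vector. -/
theorem IsRandomInit.measureReal_norm_preAct_le [IsProbabilityMeasure P] (h : IsRandomInit P W₀ a)
    (hm : 0 < m)
    {v : EuclideanSpace ℝ (Fin n)} (hv : v ≠ 0) {τ : ℝ} (h0 : 0 < τ) (h1 : τ < 1) :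
    P.real {ω | ¬((1 - τ) * ‖v‖ ^ 2 ≤ ‖preAct (W₀ ω) v‖ ^ 2 ∧
        ‖preAct (W₀ ω) v‖ ^ 2 ≤ (1 + τ) * ‖v‖ ^ 2)} ≤
      2 * Real.exp (-(m / 4 * (τ ^ 2 - τ ^ 3))) := by
  have hm' : (0 : ℝ) < m := by exact_mod_cast hm
  have hv0 : 0 < ‖v‖ := norm_pos_iff.2 hv
  set u := (‖v‖)⁻¹ • v with hu
  have hu1 : ‖u‖ = 1 := by rw [hu, norm_smul, norm_inv, norm_norm, inv_mul_cancel₀ hv0.ne']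
  have hvu : v = ‖v‖ • u := by rw [hu, smul_smul, mul_inv_cancel₀ hv0.ne', one_smul]
  refine le_of_eq_of_le ?_
    (measureReal_sum_sq_not_mem_le (h.hasLaw_inner_row hu1) (h.iIndepFun_inner_row u) h0 h1)
  congr 1
  ext ω
  have e : ‖preAct (W₀ ω) v‖ ^ 2 = ‖v‖ ^ 2 * (1 / m * ∑ k, inner ℝ (row (W₀ ω) k) u ^ 2) := by
    rw [norm_preAct_sq]
    conv_lhs => rw [hvu]
    simp only [inner_smul_right, mul_pow, ← Finset.mul_sum]
    ring
  rw [Set.mem_ofPred_eq, Set.mem_ofPred_eq, e, mul_comm (1 - τ), mul_comm (1 + τ),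
    mul_le_mul_iff_right₀ (by positivity), mul_le_mul_iff_right₀ (by positivity), one_div,
    le_inv_mul_iff₀ hm', inv_mul_le_iff₀ hm', mul_comm (m : ℝ), mul_comm (m : ℝ)]

theorem bounds_of_sq_bounds {s d τ : ℝ} (hs : 0 ≤ s) (hd : 0 ≤ d) (h0 : 0 < τ) (h1 : τ < 1)
    (h : (1 - τ) * d ^ 2 ≤ s ^ 2 ∧ s ^ 2 ≤ (1 + τ) * d ^ 2) :
    (1 - τ) * d ≤ s ∧ s ≤ (1 + τ) * d := by
  constructor
  · refine abs_le_of_sq_le_sq' ?_ hs |>.2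
    nlinarith [mul_nonneg (mul_nonneg h0.le (by linarith : 0 ≤ 1 - τ)) (sq_nonneg d)]
  · refine abs_le_of_sq_le_sq' ?_ (by positivity) |>.2
    nlinarith [mul_nonneg (mul_nonneg h0.le (by linarith : 0 ≤ 1 + τ)) (sq_nonneg d)]

/-- **Johnson–Lindenstrauss** for the random hidden layer on a finite set. -/
theorem IsRandomInit.measureReal_johnsonLindenstrauss [IsProbabilityMeasure P]
    (h : IsRandomInit P W₀ a) (hm : 0 < m) (X : Finset (EuclideanSpace ℝ (Fin n))) {ε : ℝ}
    (h0 : 0 < ε) (h1 : ε < 1) :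
    P.real {ω | ¬∀ x ∈ X, ∀ y ∈ X, (1 - ε / 2) * ‖x - y‖ ≤ ‖preAct (W₀ ω) (x - y)‖ ∧
        ‖preAct (W₀ ω) (x - y)‖ ≤ (1 + ε / 2) * ‖x - y‖} ≤
      (X.card : ℝ) * ((X.card : ℝ) - 1) * Real.exp ((m : ℝ) / 4 * (ε ^ 3 / 8 - ε ^ 2 / 4)) := by
  let B : EuclideanSpace ℝ (Fin n) → EuclideanSpace ℝ (Fin n) → Set Ω := fun x y =>
    {ω | ¬((1 - ε / 2) * ‖x - y‖ ^ 2 ≤ ‖preAct (W₀ ω) (x - y)‖ ^ 2 ∧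
        ‖preAct (W₀ ω) (x - y)‖ ^ 2 ≤ (1 + ε / 2) * ‖x - y‖ ^ 2)}
  have hB : ∀ x y, B x y = B y x := fun x y => by
    simp only [B, preAct_sub, norm_sub_rev x y,
      fun ω => norm_sub_rev (preAct (W₀ ω) x) (preAct (W₀ ω) y)]
  refine le_trans (measureReal_mono ?_) (measureReal_exists_pair_le hB (fun x y hxy => ?_) X)
  · intro ω hω
    by_contra hcon
    refine hω fun x hx y hy => ?_
    by_cases hxy : x = y
    · subst hxy
      have e := preAct_sub (W₀ ω) x x
      rw [sub_self, sub_self] at e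
      simp [e]
    · refine bounds_of_sq_bounds (norm_nonneg _) (norm_nonneg _) (by linarith) (by linarith) ?_
      by_contra hb
      exact hcon ⟨x, hx, y, hy, hxy, hb⟩
  · refine (h.measureReal_norm_preAct_le hm (sub_ne_zero.2 hxy) (by linarith)
      (by linarith)).trans_eq ?_
    congr 2
    ring

end

/-! ### Second moments of the initial Gram matrix and the initial residual -/

section

section Gram

variable {n N : ℕ}

theorem gramMatrix_isHermitian (x : Fin N → EuclideanSpace ℝ (Fin n)) :
    (gramMatrix x).IsHermitian := by
  ext i j
  simp only [gramMatrix, Matrix.conjTranspose_apply, Matrix.of_apply, star_trivial]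
  rw [dotProduct_comm]
  simp only [and_comm]

/-- The quadratic form of a real symmetric matrix is bounded below by the infimum of its
spectrum. -/
theorem sInf_spectrum_mul_le {A : Matrix (Fin N) (Fin N) ℝ} (hA : A.IsHermitian)
    (r : EuclideanSpace ℝ (Fin N)) :
    sInf (spectrum ℝ A) * ‖r‖ ^ 2 ≤ ∑ i, ∑ j, A i j * (r i * r j) := by
  set μ := sInf (spectrum ℝ A)
  have hbdd : BddBelow (spectrum ℝ A) := by
    rw [hA.spectrum_real_eq_range_eigenvalues]
    exact (Set.finite_range _).bddBelow
  have hB : (A - algebraMap ℝ _ μ).PosSemidef := by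
    rw [Matrix.posSemidef_iff_isHermitian_and_spectrum_nonneg]
    refine ⟨hA.sub (by simp [Matrix.algebraMap_eq_diagonal]), ?_⟩
    rw [← spectrum.sub_singleton_eq]
    rintro _ ⟨z, hz, _, rfl, rfl⟩
    exact sub_nonneg.2 (csInf_le hbdd hz)
  have h := hB.dotProduct_mulVec_nonneg r.ofLp
  have e : ‖r‖ ^ 2 = ∑ i, r i * r i := by
    rw [EuclideanSpace.norm_sq_eq]
    exact Finset.sum_congr rfl fun i _ => by rw [Real.norm_eq_abs, sq_abs, sq]
  have e2 : A *ᵥ r.ofLp ⬝ᵥ r.ofLp = ∑ i, ∑ j, A i j * (r i * r j) := by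
    simp only [dotProduct, Matrix.mulVec, Finset.sum_mul]
    exact Finset.sum_congr rfl fun i _ => Finset.sum_congr rfl fun j _ => by ring
  have e3 : (algebraMap ℝ (Matrix (Fin N) (Fin N) ℝ) μ) *ᵥ r.ofLp = μ • r.ofLp := by
    rw [Matrix.algebraMap_eq_diagonal]
    ext i
    simp [Matrix.mulVec_diagonal]
  rw [Matrix.sub_mulVec, e3, star_trivial, dotProduct_comm, sub_dotProduct, e2,
    smul_dotProduct] at h
  rw [e]
  simpa [dotProduct] using h

/-- The summand of the Gram matrices, as a function of the weight vector of a neuron. -/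
def gramKernel (x y : EuclideanSpace ℝ (Fin n)) (z : Fin n → ℝ) : ℝ :=
  inner ℝ x y * (reluDeriv (inner ℝ (WithLp.toLp 2 z : EuclideanSpace ℝ (Fin n)) x) *
    reluDeriv (inner ℝ (WithLp.toLp 2 z : EuclideanSpace ℝ (Fin n)) y))

theorem measurable_reluDeriv : Measurable reluDeriv :=
  Measurable.ite measurableSet_Ici measurable_const measurable_const

theorem measurable_gramKernel (x y : EuclideanSpace ℝ (Fin n)) : Measurable (gramKernel x y) := by
  unfold gramKernel
  have := measurable_reluDeriv
  fun_prop

theorem abs_gramKernel_le_one {x y : EuclideanSpace ℝ (Fin n)} (hx : ‖x‖ = 1) (hy : ‖y‖ = 1)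
    (z : Fin n → ℝ) : |gramKernel x y z| ≤ 1 := by
  rw [gramKernel, abs_mul, abs_mul, abs_of_nonneg (reluDeriv_nonneg _),
    abs_of_nonneg (reluDeriv_nonneg _)]
  exact mul_le_one₀ (abs_inner_le_one hx hy)
    (mul_nonneg (reluDeriv_nonneg _) (reluDeriv_nonneg _))
    (mul_le_one₀ (reluDeriv_le_one _) (reluDeriv_nonneg _) (reluDeriv_le_one _))

theorem gramMatrix_apply (x : Fin N → EuclideanSpace ℝ (Fin n)) (i j : Fin N) :
    gramMatrix x i j =
      ∫ z, gramKernel (x i) (x j) z ∂(Measure.pi fun _ : Fin n => gaussianReal 0 1) := by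
  simp only [gramMatrix, Matrix.of_apply]
  refine integral_congr_ae (ae_of_all _ fun z => ?_)
  have e : ∀ v : EuclideanSpace ℝ (Fin n),
      inner ℝ (WithLp.toLp 2 z : EuclideanSpace ℝ (Fin n)) v = z ⬝ᵥ v.ofLp := fun v => by
    simp [PiLp.inner_apply, dotProduct, mul_comm]
  have e' : inner ℝ (x i) (x j) = (x i).ofLp ⬝ᵥ (x j).ofLp := by
    simp [PiLp.inner_apply, dotProduct, mul_comm]
  simp only [gramKernel, e, e', reluDeriv, Set.indicator_apply, Set.mem_ofPred_eq]
  split_ifs <;> simp_all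

theorem lambdaMin_le_one (hN : 0 < N) {x : Fin N → EuclideanSpace ℝ (Fin n)}
    (hx : ∀ i, ‖x i‖ = 1) : lambdaMin x ≤ 1 := by
  have h := sInf_spectrum_mul_le (gramMatrix_isHermitian x) (EuclideanSpace.single ⟨0, hN⟩ 1)
  have e : ∑ i, ∑ j, gramMatrix x i j * ((EuclideanSpace.single (⟨0, hN⟩ : Fin N) (1 : ℝ)) i *
      (EuclideanSpace.single (⟨0, hN⟩ : Fin N) (1 : ℝ)) j) =
      gramMatrix x ⟨0, hN⟩ ⟨0, hN⟩ := by
    simp [PiLp.single_apply]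
  rw [e, gramMatrix_apply] at h
  simp only [PiLp.norm_single, norm_one, one_pow, mul_one] at h
  refine h.trans ((le_abs_self _).trans ?_)
  rw [← Real.norm_eq_abs]
  refine (norm_integral_le_of_norm_le_const (C := 1) (ae_of_all _ fun z => ?_)).trans_eq (by simp)
  exact abs_gramKernel_le_one (hx _) (hx _) z

end Gram

variable {m n N : ℕ} {Ω : Type*} [MeasurableSpace Ω] {P : Measure Ω}

/-- The mean square error of an average of `m` independent variables with common mean is at most
`1 / m` times a bound on their second moments. -/
theorem integral_sq_average_sub_le [IsProbabilityMeasure P] (hm : 0 < m) {X : Fin m → Ω → ℝ}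
    (hX : ∀ k, MemLp (X k) 2 P) (hind : iIndepFun X P) {μ B : ℝ} (hμ : ∀ k, ∫ ω, X k ω ∂P = μ)
    (hB : ∀ k, ∫ ω, X k ω ^ 2 ∂P ≤ B) :
    Integrable (fun ω => (1 / (m : ℝ) * ∑ k, X k ω - μ) ^ 2) P ∧
      ∫ ω, (1 / (m : ℝ) * ∑ k, X k ω - μ) ^ 2 ∂P ≤ B / m := by
  have hm' : (0 : ℝ) < m := by exact_mod_cast hm
  have hS : MemLp (fun ω => 1 / (m : ℝ) * ∑ k, X k ω) 2 P :=
    (memLp_finsetSum Finset.univ fun k _ => hX k).const_mul _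
  refine ⟨(hS.sub (memLp_const μ)).integrable_sq, ?_⟩
  have hmean : P[fun ω => 1 / (m : ℝ) * ∑ k, X k ω] = μ := by
    rw [integral_const_mul, integral_finsetSum _ fun k _ => (hX k).integrable (by norm_num)]
    simp [hμ, hm'.ne']
  have hvar := variance_eq_integral hS.aestronglyMeasurable.aemeasurable
  rw [hmean] at hvar
  rw [← hvar, variance_const_mul]
  have hsum := IndepFun.variance_sum (s := Finset.univ) (fun k _ => hX k)
    (fun i _ j _ hij => hind.indepFun hij)
  have e : (∑ k, X k) = fun ω => ∑ k, X k ω := by ext; simp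
  rw [e] at hsum
  rw [hsum]
  have hk : ∀ k ∈ Finset.univ, Var[X k; P] ≤ B := fun k _ =>
    (variance_le_expectation_sq (hX k).aestronglyMeasurable).trans (hB k)
  have hs := Finset.sum_le_card_nsmul _ _ _ hk
  simp only [Finset.card_univ, Fintype.card_fin, nsmul_eq_mul] at hs
  calc (1 / (m : ℝ)) ^ 2 * ∑ k, Var[X k; P] ≤ (1 / (m : ℝ)) ^ 2 * (m * B) := by gcongr
    _ = B / m := by field_simp

theorem integral_sq_gaussianReal : ∫ z, z ^ 2 ∂(gaussianReal 0 1) = 1 := by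
  have h := variance_eq_integral (X := fun x => x) (μ := gaussianReal 0 1) (by fun_prop)
  rw [variance_fun_id_gaussianReal, integral_id_gaussianReal] at h
  simpa using h.symm

/-- Anti-concentration of the standard normal distribution. -/
theorem integral_ite_abs_le_gaussianReal {R : ℝ} (hR : 0 ≤ R) :
    ∫ z, (if |z| ≤ R then (1 : ℝ) else 0) ∂(gaussianReal 0 1) ≤ R := by
  rw [integral_gaussianReal_eq_integral_smul one_ne_zero]
  have hpdf : ∀ z, gaussianPDFReal 0 1 z ≤ 1 / 2 := by
    intro z
    rw [gaussianPDFReal]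
    have h1 : (2 : ℝ) ≤ √(2 * Real.pi * (1 : NNReal)) := by
      apply Real.le_sqrt_of_sq_le
      simp only [NNReal.coe_one, mul_one]
      linarith [Real.pi_gt_three]
    have h2 : Real.exp (-(z - 0) ^ 2 / (2 * (1 : NNReal))) ≤ 1 := by
      rw [Real.exp_le_one_iff]
      exact div_nonpos_of_nonpos_of_nonneg (by simp [sq_nonneg]) (by positivity)
    calc _ ≤ (√(2 * Real.pi * (1 : NNReal)))⁻¹ * 1 := by gcongr
      _ ≤ 1 / 2 := by rw [mul_one, one_div]; exact inv_anti₀ two_pos h1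
  have hI : Integrable ((Set.Icc (-R) R).indicator fun _ => (1 / 2 : ℝ)) volume :=
    (integrable_indicator_iff measurableSet_Icc).2 (integrableOn_const (by simp))
  have hle : ∫ z, gaussianPDFReal 0 1 z • (if |z| ≤ R then (1 : ℝ) else 0) ≤
      ∫ z, (Set.Icc (-R) R).indicator (fun _ => (1 / 2 : ℝ)) z := by
    refine integral_mono_of_nonneg (ae_of_all _ fun z => ?_) hI (ae_of_all _ fun z => ?_)
    · have := gaussianPDFReal_nonneg 0 1 z
      simp only [Pi.zero_apply, smul_eq_mul]
      split_ifs <;> simp [this]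
    · simp only [Set.indicator_apply, Set.mem_Icc, abs_le, smul_eq_mul]
      split_ifs <;> simp
      simpa using hpdf z
  refine hle.trans_eq ?_
  rw [integral_indicator measurableSet_Icc, setIntegral_const]
  simp only [Measure.real, Real.volume_Icc, smul_eq_mul]
  rw [ENNReal.toReal_ofReal (by linarith)]
  ring

variable {W₀ : Ω → Matrix (Fin m) (Fin n) ℝ} {a : Ω → Fin m → ℝ}

namespace IsRandomInit

/-- The entries of the initial empirical Gram matrix are averages of `m` independent bounded
variables with the entries of `gramMatrix` as means. -/
theorem integrable_sq_empGram_sub [IsProbabilityMeasure P] (h : IsRandomInit P W₀ a) (hm : 0 < m)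
    {x : Fin N → EuclideanSpace ℝ (Fin n)} (hx : ∀ i, ‖x i‖ = 1) (i j : Fin N) :
    Integrable (fun ω => (empGram x (W₀ ω) i j - gramMatrix x i j) ^ 2) P ∧
      ∫ ω, (empGram x (W₀ ω) i j - gramMatrix x i j) ^ 2 ∂P ≤ 1 / m := by
  have hmeas := measurable_gramKernel (x i) (x j)
  have haem : ∀ k, AEMeasurable (fun ω => gramKernel (x i) (x j) (W₀ ω k)) P := fun k =>
    hmeas.comp_aemeasurable (h.aemeasurable_row k)
  have hb : ∀ k ω, ‖gramKernel (x i) (x j) (W₀ ω k)‖ ≤ 1 := fun k ω =>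
    abs_gramKernel_le_one (hx i) (hx j) _
  refine integral_sq_average_sub_le hm
    (X := fun k ω => gramKernel (x i) (x j) (W₀ ω k)) (fun k => ?_) ?_ (fun k => ?_) fun k => ?_
  · exact MemLp.of_bound (haem k).aestronglyMeasurable 1 (ae_of_all _ (hb k))
  · exact h.iIndepFun_neuron.comp (fun _ z => gramKernel (x i) (x j) z.1) fun _ => by fun_prop
  · rw [gramMatrix_apply]
    exact (h.hasLaw_row k).integral_comp hmeas.aestronglyMeasurable
  · have h1 := integral_mono_of_nonneg (μ := P) (f := fun ω => gramKernel (x i) (x j) (W₀ ω k) ^ 2)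
      (g := fun _ => 1) (ae_of_all _ fun ω => sq_nonneg _) (integrable_const _)
      (ae_of_all _ fun ω => (sq_le_one_iff_abs_le_one _).2 (hb k ω))
    simpa using h1

theorem integrable_unstableFrac [IsProbabilityMeasure P] (h : IsRandomInit P W₀ a) (hm : 0 < m)
    {x : Fin N → EuclideanSpace ℝ (Fin n)} (hx : ∀ i, ‖x i‖ = 1) {R : ℝ} (hR : 0 ≤ R) :
    Integrable (fun ω => unstableFrac x (W₀ ω) R) P ∧
      ∫ ω, unstableFrac x (W₀ ω) R ∂P ≤ N * R := by
  have hm' : (0 : ℝ) < m := by exact_mod_cast hm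
  have hmeas : Measurable fun z : ℝ => if |z| ≤ R then (1 : ℝ) else 0 :=
    Measurable.ite (measurableSet_le (by fun_prop) measurable_const) measurable_const
      measurable_const
  have hint : ∀ i k, Integrable (fun ω => unstable (W₀ ω) R (x i) k) P := fun i k =>
    Integrable.of_bound (hmeas.comp_aemeasurable
      (h.hasLaw_inner_row (hx i) k).aemeasurable).aestronglyMeasurable 1 (ae_of_all _ fun ω => by
        unfold unstable; split_ifs <;> simp)
  have hle : ∀ i k, ∫ ω, unstable (W₀ ω) R (x i) k ∂P ≤ R := fun i k =>
    ((h.hasLaw_inner_row (hx i) k).integral_comp hmeas.aestronglyMeasurable).trans_le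
      (integral_ite_abs_le_gaussianReal hR)
  have hint2 : ∀ i, Integrable (fun ω => 1 / (m : ℝ) * ∑ k, unstable (W₀ ω) R (x i) k) P :=
    fun i => (integrable_finsetSum _ fun k _ => hint i k).const_mul _
  refine ⟨integrable_finsetSum _ fun i _ => hint2 i, ?_⟩
  unfold unstableFrac
  rw [integral_finsetSum _ fun i _ => hint2 i]
  refine (Finset.sum_le_card_nsmul _ _ R fun i _ => ?_).trans_eq (by simp)
  rw [integral_const_mul, integral_finsetSum _ fun k _ => hint i k, one_div, inv_mul_le_iff₀ hm']
  exact (Finset.sum_le_card_nsmul _ _ R fun k _ => hle i k).trans_eq (by simp)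

theorem indepFun_sign_inner_row (h : IsRandomInit P W₀ a) (v : EuclideanSpace ℝ (Fin n))
    (k : Fin m) : IndepFun (fun ω => a ω k) (fun ω => inner ℝ (row (W₀ ω) k) v) P := by
  classical
  let S : Finset ((Fin m × Fin n) ⊕ Fin m) := {Sum.inr k}
  let T : Finset ((Fin m × Fin n) ⊕ Fin m) := Finset.univ.image fun j => Sum.inl (k, j)
  have hdisj : Disjoint S T := by
    simp [S, T]
  have hI := h.indep.indepFun_finset₀ S T hdisj (by
    rintro (p | k)
    · exact (h.law_W p.1 p.2).aemeasurable
    · exact (h.law_a k).aemeasurable)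
  have hT : ∀ j, Sum.inl (k, j) ∈ T := fun j => by simp [T]
  have hφ : Measurable fun z : S → ℝ => z ⟨Sum.inr k, by simp [S]⟩ := measurable_pi_apply _
  have hψ : Measurable fun z : T → ℝ => ∑ j, z ⟨Sum.inl (k, j), hT j⟩ * v j := by fun_prop
  have e : (fun ω => inner ℝ (row (W₀ ω) k) v) = fun ω => ∑ j, W₀ ω k j * v j := by
    funext ω
    simp [row, PiLp.inner_apply, mul_comm]
  rw [e]
  exact hI.comp hφ hψ

/-- The initial predictions have bounded second moments because the random signs make the
contributions of the neurons centred, hence orthogonal. -/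
theorem integrable_sq_network [IsProbabilityMeasure P] (h : IsRandomInit P W₀ a) (hm : 0 < m)
    {v : EuclideanSpace ℝ (Fin n)} (hv : ‖v‖ = 1) :
    Integrable (fun ω => network (W₀ ω) (a ω) v ^ 2) P ∧
      ∫ ω, network (W₀ ω) (a ω) v ^ 2 ∂P ≤ 1 := by
  have hm' : (0 : ℝ) < m := by exact_mod_cast hm
  have hrelu : Measurable relu := by unfold relu; fun_prop
  let X : Fin m → Ω → ℝ := fun k ω => a ω k * relu (inner ℝ (row (W₀ ω) k) v)
  have hlaw := fun k => h.hasLaw_inner_row hv k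
  have hreluae : ∀ k, AEMeasurable (fun ω => relu (inner ℝ (row (W₀ ω) k) v)) P := fun k =>
    hrelu.comp_aemeasurable (hlaw k).aemeasurable
  have hae : ∀ k, AEMeasurable (X k) P := fun k => (h.law_a k).aemeasurable.mul (hreluae k)
  have hL2 : ∀ k, MemLp (fun ω => inner ℝ (row (W₀ ω) k) v) 2 P := fun k =>
    ((hlaw k).hasGaussianLaw).memLp_two
  have hsq : ∀ k, ∀ᵐ ω ∂P, X k ω ^ 2 ≤ inner ℝ (row (W₀ ω) k) v ^ 2 := by
    intro k
    filter_upwards [h.ae_sq_eq_one] with ω hω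
    simp only [X]
    rw [mul_pow, hω k, one_mul]
    unfold relu
    rcases max_cases 0 (inner ℝ (row (W₀ ω) k) v) with ⟨h1, h2⟩ | ⟨h1, h2⟩ <;> rw [h1]
    nlinarith [sq_nonneg (inner ℝ (row (W₀ ω) k) v)]
  have hX2 : ∀ k, MemLp (X k) 2 P := fun k => (hL2 k).mono (hae k).aestronglyMeasurable (by
    filter_upwards [hsq k] with ω hω
    exact sq_le_sq.1 hω)
  have hmean : ∀ k, ∫ ω, X k ω ∂P = 0 := fun k => by
    have hI := (h.indepFun_sign_inner_row v k).comp (φ := id) (ψ := relu) measurable_id hrelu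
    have := hI.integral_fun_mul_eq_mul_integral
      (h.law_a k).aemeasurable.aestronglyMeasurable (hreluae k).aestronglyMeasurable
    simp only [Function.comp_def, id] at this
    rw [this, h.integral_sign k, zero_mul]
  have hsecond : ∀ k, ∫ ω, X k ω ^ 2 ∂P ≤ 1 := fun k => by
    refine (integral_mono_ae (hX2 k).integrable_sq (hL2 k).integrable_sq (hsq k)).trans_eq ?_
    rw [← integral_sq_gaussianReal]
    exact (hlaw k).integral_comp (f := fun z => z ^ 2) (by fun_prop)
  have hind : iIndepFun X P := by
    refine h.iIndepFun_neuron.comp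
      (fun _ z => z.2 * relu (inner ℝ (WithLp.toLp 2 z.1 : EuclideanSpace ℝ (Fin n)) v))
      fun _ => ?_
    fun_prop
  obtain ⟨h1, h2⟩ := integral_sq_average_sub_le hm hX2 hind hmean hsecond
  have e : ∀ ω, network (W₀ ω) (a ω) v ^ 2 = m * (1 / (m : ℝ) * ∑ k, X k ω - 0) ^ 2 := by
    intro ω
    have e1 : network (W₀ ω) (a ω) v = 1 / √m * ∑ k, X k ω := by
      rw [network, Finset.mul_sum]
      refine Finset.sum_congr rfl fun k _ => ?_
      rw [preAct_apply, relu_mul_of_nonneg (by positivity)]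
      simp only [X]
      ring
    rw [e1, sub_zero, mul_pow, mul_pow, div_pow, div_pow, Real.sq_sqrt hm'.le]
    field_simp
  simp_rw [e]
  refine ⟨h1.const_mul _, ?_⟩
  rw [integral_const_mul]
  calc _ ≤ (m : ℝ) * (1 / m) := by gcongr
    _ = 1 := by field_simp

/-- The majorant `f` avoids computing the cross terms of the squared residual. -/
theorem exists_integrable_ge_sq_residual [IsProbabilityMeasure P] (h : IsRandomInit P W₀ a)
    (hm : 0 < m) {x : Fin N → EuclideanSpace ℝ (Fin n)} (hx : ∀ i, ‖x i‖ = 1) {y : EuclideanSpace ℝ (Fin N)}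
    {C : ℝ} (hy : ∀ i, |y i| ≤ C) :
    ∃ f : Ω → ℝ, (∀ ω, ‖prediction x (a ω) (W₀ ω) - y‖ ^ 2 ≤ f ω) ∧ Integrable f P ∧
      ∫ ω, f ω ∂P ≤ 2 * N * (1 + C ^ 2) := by
  have hi := fun i => h.integrable_sq_network hm (hx i)
  have hint : ∀ i, Integrable (fun ω => 2 * network (W₀ ω) (a ω) (x i) ^ 2 + 2 * C ^ 2) P :=
    fun i => ((hi i).1.const_mul 2).add (integrable_const _)
  refine ⟨fun ω => ∑ i, (2 * network (W₀ ω) (a ω) (x i) ^ 2 + 2 * C ^ 2), fun ω => ?_,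
    integrable_finsetSum _ fun i _ => hint i, ?_⟩
  · rw [EuclideanSpace.norm_sq_eq]
    refine Finset.sum_le_sum fun i _ => ?_
    rw [Real.norm_eq_abs, sq_abs]
    have h1 : y i ^ 2 ≤ C ^ 2 := sq_le_sq' (neg_le_of_abs_le (hy i)) (le_of_abs_le (hy i))
    simp only [prediction, PiLp.sub_apply]
    nlinarith [sq_nonneg (network (W₀ ω) (a ω) (x i) + y i)]
  · rw [integral_finsetSum _ fun i _ => hint i]
    refine (Finset.sum_le_card_nsmul _ _ (2 * (1 + C ^ 2)) fun i _ => ?_).trans_eq (by simp; ring)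
    rw [integral_add ((hi i).1.const_mul 2) (integrable_const _), integral_const_mul]
    simp
    linarith [(hi i).2]

end IsRandomInit

end

/-! ### Combining the estimates -/

section

variable {m n N : ℕ}

/-- Markov's inequality for real random variables. -/
theorem measureReal_ge_le_div {Ω : Type*} [MeasurableSpace Ω] {P : Measure Ω} {f : Ω → ℝ}
    (hf : ∀ ω, 0 ≤ f ω) (hint : Integrable f P) {t B : ℝ} (ht : 0 < t) (hB : ∫ ω, f ω ∂P ≤ B) :
    P.real {ω | t ≤ f ω} ≤ B / t := by
  rw [le_div_iff₀' ht]
  exact (mul_meas_ge_le_integral_of_nonneg (ae_of_all _ hf) hint t).trans hB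

/-- Perturbing the limiting Gram matrix by less than a quarter of its smallest eigenvalue, in
Frobenius norm, leaves it coercive. -/
theorem quadForm_empGram_ge {x : Fin N → EuclideanSpace ℝ (Fin n)}
    {W : Matrix (Fin m) (Fin n) ℝ} (hpos : 0 < lambdaMin x)
    (hfro : ∑ i, ∑ j, (empGram x W i j - gramMatrix x i j) ^ 2 < lambdaMin x ^ 2 / 16)
    (r : EuclideanSpace ℝ (Fin N)) :
    3 / 4 * lambdaMin x * ‖r‖ ^ 2 ≤ ∑ i, ∑ j, empGram x W i j * (r i * r j) := by
  have h1 : lambdaMin x * ‖r‖ ^ 2 ≤ _ := sInf_spectrum_mul_le (gramMatrix_isHermitian x) r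
  have h2 := sq_quadForm_le (fun i j => empGram x W i j - gramMatrix x i j) r
  have h3 : (∑ i, ∑ j, (empGram x W i j - gramMatrix x i j) * (r i * r j)) ^ 2 ≤
      (lambdaMin x / 4 * ‖r‖ ^ 2) ^ 2 := by
    refine h2.trans ?_
    rw [mul_pow, div_pow]
    norm_num only
    exact mul_le_mul_of_nonneg_right hfro.le (sq_nonneg _)
  have h4 := (abs_le_of_sq_le_sq' h3 (by positivity)).1
  simp only [sub_mul, Finset.sum_sub_distrib] at h4
  linarith

/-- At a good initialization, the hidden layer of the trained network is an isomorphism of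
neighbourhood graphs at every step: training moves it by at most `ε / 2` in operator norm, which
adds to the distortion `ε / 2` of the random hidden layer. -/
theorem isRGraphIso_gradDescent (hm : 0 < m) (hN : 0 < N) {x : Fin N → EuclideanSpace ℝ (Fin n)}
    (hx : ∀ i, ‖x i‖ = 1) {y : EuclideanSpace ℝ (Fin N)} {a : Fin m → ℝ}
    (ha : ∀ k, a k ^ 2 = 1) {W₀ : Matrix (Fin m) (Fin n) ℝ} {η R : ℝ} (hη : 0 ≤ η)
    (hpos : 0 < lambdaMin x) (hηN : η * (N : ℝ) ^ 2 ≤ lambdaMin x / 4)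
    (hfro : ∑ i, ∑ j, (empGram x W₀ i j - gramMatrix x i j) ^ 2 < lambdaMin x ^ 2 / 16)
    (hstab : unstableFrac x W₀ R ≤ lambdaMin x / (8 * N))
    (hR : 4 * √N * ‖prediction x a W₀ - y‖ / (√m * lambdaMin x) ≤ R)
    {X : Finset (EuclideanSpace ℝ (Fin n))} {r ε : ℝ} (hε0 : 0 < ε) (hε1 : ε < 1)
    (hgap : GapCondition r ε (X : Set (EuclideanSpace ℝ (Fin n))))
    (hJL : ∀ x ∈ X, ∀ y ∈ X, (1 - ε / 2) * ‖x - y‖ ≤ ‖preAct W₀ (x - y)‖ ∧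
        ‖preAct W₀ (x - y)‖ ≤ (1 + ε / 2) * ‖x - y‖)
    (hmε : 64 * (N : ℝ) * ‖prediction x a W₀ - y‖ ^ 2 / (ε ^ 2 * lambdaMin x ^ 2) ≤ (m : ℝ))
    (l : ℕ) :
    IsRGraphIso r (X : Set (EuclideanSpace ℝ (Fin n))) (preAct (gradDescent x y a η W₀ l)) := by
  have hm' : (0 : ℝ) < m := by exact_mod_cast hm
  have hs0 : 0 < √(m : ℝ) := Real.sqrt_pos.2 hm'
  have hlam := lambdaMin_le_one hN hx
  set W := gradDescent x y a η W₀ l with hW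
  set D := 4 * √N * ‖prediction x a W₀ - y‖ / (√m * lambdaMin x) with hD
  have hD0 : 0 ≤ D := by positivity
  have hDε : D ≤ ε / 2 := by
    refine abs_le_of_sq_le_sq' ?_ (by linarith) |>.2
    rw [hD, div_pow, mul_pow, mul_pow, mul_pow, Real.sq_sqrt hm'.le,
      Real.sq_sqrt (Nat.cast_nonneg N), div_le_iff₀ (by positivity)]
    rw [div_le_iff₀ (by positivity)] at hmε
    linarith
  have hrow : ∀ k, ‖row W k - row W₀ k‖ ≤ D := fun k => by
    refine ((gradDescent_invariant hm hx y ha hη hpos hlam hN hηN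
      (quadForm_empGram_ge hpos hfro) hstab hR l).2 k).trans (mul_le_of_le_one_right hD0 ?_)
    have hq : 0 ≤ 1 - η * lambdaMin x / 4 := by
      have hN1 : (1 : ℝ) ≤ N := by exact_mod_cast hN
      have := mul_le_mul_of_nonneg_left (one_le_pow₀ hN1 : (1 : ℝ) ≤ (N : ℝ) ^ 2) hη
      nlinarith
    linarith [pow_nonneg hq l]
  have hclose : ∀ v, ‖preAct W v - preAct W₀ v‖ ≤ ε / 2 * ‖v‖ := fun v =>
    (norm_preAct_sub_le hm hD0 hrow v).trans (mul_le_mul_of_nonneg_right hDε (norm_nonneg v))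
  refine isRGraphIso_of_distortion X.finite_toSet hε1 hgap ?_ ?_ hε0
  · intro p hp q hq
    rw [dist_eq_norm, dist_eq_norm, ← preAct_sub]
    have h1 := (hJL p hp q hq).1
    have h2 := hclose (p - q)
    have h3 := norm_sub_norm_le (preAct W₀ (p - q)) (preAct W (p - q))
    rw [norm_sub_rev] at h3
    linarith
  · intro p hp q hq
    rw [dist_eq_norm, dist_eq_norm, ← preAct_sub]
    have h1 := (hJL p hp q hq).2
    have h2 := hclose (p - q)
    have h3 := norm_sub_norm_le (preAct W (p - q)) (preAct W₀ (p - q))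
    linarith

/-- The random initialization is good up to an exceptional event: the three Markov bounds for the
Gram matrix, the unstable neurons and the initial residual contribute `δ / 3` each, and the rest is
the Johnson–Lindenstrauss term. -/
theorem IsRandomInit.le_measureReal_isRGraphIso {C : ℝ} {x : Fin N → EuclideanSpace ℝ (Fin n)}
    {y : EuclideanSpace ℝ (Fin N)} {δ η : ℝ} (hx : ∀ i, ‖x i‖ = 1) (hy : ∀ i, |y i| ≤ C)
    (hpos : 0 < lambdaMin x) (hδ : 0 < δ) (hδ1 : δ < 1) (hN : 0 < N) (hm : 0 < m)
    (hmK : 55296 * (1 + C ^ 2) * ((N : ℝ) ^ 6 / (lambdaMin x ^ 4 * δ ^ 3)) ≤ (m : ℝ))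
    (hη : 0 < η) (hηc : η ≤ 1 / 4 * (lambdaMin x / (N : ℝ) ^ 2))
    {Ω : Type*} [MeasurableSpace Ω] {P : Measure Ω} [IsProbabilityMeasure P]
    {W₀ : Ω → Matrix (Fin m) (Fin n) ℝ} {a : Ω → Fin m → ℝ} (h : IsRandomInit P W₀ a)
    {X : Finset (EuclideanSpace ℝ (Fin n))} {r ε : ℝ} (hε0 : 0 < ε) (hε1 : ε < 1)
    (hgap : GapCondition r ε (X : Set (EuclideanSpace ℝ (Fin n)))) :
    1 - δ - (X.card : ℝ) * ((X.card : ℝ) - 1) *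
        Real.exp ((m : ℝ) / 4 * (ε ^ 3 / 8 - ε ^ 2 / 4)) ≤
      P.real {ω |
        64 * (N : ℝ) * ‖prediction x (a ω) (W₀ ω) - y‖ ^ 2 / (ε ^ 2 * lambdaMin x ^ 2) ≤ (m : ℝ) →
        ∀ l : ℕ, IsRGraphIso r (X : Set (EuclideanSpace ℝ (Fin n)))
          (preAct (gradDescent x y (a ω) η (W₀ ω) l))} := by
  have hm' : (0 : ℝ) < m := by exact_mod_cast hm
  have hN1 : (1 : ℝ) ≤ N := by exact_mod_cast hN
  have hlam1 := lambdaMin_le_one hN hx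
  set μ := lambdaMin x with hμ
  have hC1 : 1 ≤ 1 + C ^ 2 := by nlinarith [sq_nonneg C]
  -- the radius within which the rows are to stay: the largest one for which Markov's inequality
  -- bounds the probability of too many unstable neurons by `δ / 3`
  set R := μ * δ / (24 * (N : ℝ) ^ 2) with hRdef
  have hR0 : 0 ≤ R := by positivity
  have hmK' : 55296 * (1 + C ^ 2) * (N : ℝ) ^ 6 ≤ m * (μ ^ 4 * δ ^ 3) := by
    rwa [← mul_div_assoc, div_le_iff₀ (by positivity)] at hmK
  obtain ⟨f, hf, hfint, hfle⟩ := h.exists_integrable_ge_sq_residual hm hx hy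
  have hf0 : ∀ ω, 0 ≤ f ω := fun ω => (sq_nonneg _).trans (hf ω)
  set F : Ω → ℝ := fun ω => ∑ i, ∑ j, (empGram x (W₀ ω) i j - gramMatrix x i j) ^ 2 with hF
  have hFint : Integrable F P := integrable_finsetSum _ fun i _ => integrable_finsetSum _ fun j _ =>
    (h.integrable_sq_empGram_sub hm hx i j).1
  have hFle : ∫ ω, F ω ∂P ≤ (N : ℝ) ^ 2 / m := by
    rw [hF, integral_finsetSum _ fun i _ => integrable_finsetSum _ fun j _ =>
      (h.integrable_sq_empGram_sub hm hx i j).1]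
    refine (Finset.sum_le_card_nsmul _ _ ((N : ℝ) / m) fun i _ => ?_).trans_eq (by simp; ring)
    rw [integral_finsetSum _ fun j _ => (h.integrable_sq_empGram_sub hm hx i j).1]
    refine (Finset.sum_le_card_nsmul _ _ _ fun j _ =>
      (h.integrable_sq_empGram_sub hm hx i j).2).trans_eq (by simp [div_eq_mul_inv])
  set E₁ := {ω | μ ^ 2 / 16 ≤ F ω} with hE₁
  set E₂ := {ω | μ / (8 * N) ≤ unstableFrac x (W₀ ω) R} with hE₂
  set E₃ := {ω | 6 * N * (1 + C ^ 2) / δ ≤ f ω} with hE₃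
  set E₄ := {ω | ¬∀ x ∈ X, ∀ y ∈ X, (1 - ε / 2) * ‖x - y‖ ≤ ‖preAct (W₀ ω) (x - y)‖ ∧
        ‖preAct (W₀ ω) (x - y)‖ ≤ (1 + ε / 2) * ‖x - y‖} with hE₄
  set E₅ := {ω | ¬∀ k, a ω k ^ 2 = 1} with hE₅
  have hP₁ : P.real E₁ ≤ δ / 3 := by
    refine (measureReal_ge_le_div
      (fun ω => Finset.sum_nonneg fun i _ => Finset.sum_nonneg fun j _ => sq_nonneg _) hFint (by positivity) hFle).trans ?_
    rw [div_div, div_le_div_iff₀ (by positivity) (by norm_num)]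
    -- `m ≥ K N⁶ / (μ⁴ δ³)` is much more than the `48 N² / (μ² δ)` needed here
    have h1 : μ ^ 4 * δ ^ 3 ≤ μ ^ 2 * δ := by
      have h2 : μ ^ 4 ≤ μ ^ 2 := pow_le_pow_of_le_one hpos.le hlam1 (by norm_num)
      have h3 : δ ^ 3 ≤ δ := pow_le_of_le_one hδ.le hδ1.le (by norm_num)
      gcongr
    have h2 : (N : ℝ) ^ 2 ≤ (N : ℝ) ^ 6 := pow_le_pow_right₀ hN1 (by norm_num)
    have h3 : (N : ℝ) ^ 6 ≤ (1 + C ^ 2) * (N : ℝ) ^ 6 := le_mul_of_one_le_left (by positivity) hC1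
    have h4 := mul_le_mul_of_nonneg_left h1 hm'.le
    nlinarith
  have hP₂ : P.real E₂ ≤ δ / 3 := by
    have hu := h.integrable_unstableFrac hm hx hR0
    refine (measureReal_ge_le_div (fun ω => unstableFrac_nonneg _ _ _) hu.1
      (by positivity) hu.2).trans_eq ?_
    rw [hRdef]
    field_simp
    norm_num
  have hP₃ : P.real E₃ ≤ δ / 3 := by
    refine (measureReal_ge_le_div hf0 hfint (by positivity) hfle).trans_eq ?_
    field_simp
    norm_num
  have hP₄ := h.measureReal_johnsonLindenstrauss hm X hε0 hε1
  have hP₅ : P.real E₅ = 0 := by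
    rw [measureReal_def, ae_iff.1 h.ae_sq_eq_one, ENNReal.toReal_zero]
  set G := {ω |
        64 * (N : ℝ) * ‖prediction x (a ω) (W₀ ω) - y‖ ^ 2 / (ε ^ 2 * μ ^ 2) ≤ (m : ℝ) →
        ∀ l : ℕ, IsRGraphIso r (X : Set (EuclideanSpace ℝ (Fin n)))
          (preAct (gradDescent x y (a ω) η (W₀ ω) l))} with hG
  have hcover : (Set.univ : Set Ω) ⊆ G ∪ (E₁ ∪ (E₂ ∪ (E₃ ∪ (E₄ ∪ E₅)))) := by
    intro ω _
    by_contra hcon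
    simp only [Set.mem_union, not_or] at hcon
    obtain ⟨hnG, h1, h2, h3, h4, h5⟩ := hcon
    simp only [hE₁, hE₂, hE₃, hE₄, hE₅, Set.mem_ofPred_eq, not_le, not_not] at h1 h2 h3 h4 h5
    refine hnG fun hmε l => isRGraphIso_gradDescent hm hN hx h5 hη.le hpos ?_ h1 h2.le ?_
      hε0 hε1 hgap h4 hmε l
    · rw [mul_div_assoc', le_div_iff₀ (by positivity)] at hηc
      linarith
    · refine abs_le_of_sq_le_sq' ?_ hR0 |>.2
      have hres := (hf ω).trans h3.le
      rw [le_div_iff₀ hδ] at hres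
      rw [hRdef, div_pow, div_pow, mul_pow, mul_pow, mul_pow, Real.sq_sqrt hm'.le,
        Real.sq_sqrt (Nat.cast_nonneg N), div_le_div_iff₀ (by positivity) (by positivity)]
      -- after multiplication by `δ`, this is the assumption on `m`
      refine le_of_mul_le_mul_right ?_ hδ
      calc _ = 16 * 576 * (N : ℝ) ^ 5 * (‖prediction x (a ω) (W₀ ω) - y‖ ^ 2 * δ) := by ring
        _ ≤ 16 * 576 * (N : ℝ) ^ 5 * (6 * N * (1 + C ^ 2)) := by gcongr
        _ = 55296 * (1 + C ^ 2) * (N : ℝ) ^ 6 := by ring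
        _ ≤ m * (μ ^ 4 * δ ^ 3) := hmK'
        _ = _ := by rw [← hμ]; ring
  have hone : (1 : ℝ) ≤ P.real (G ∪ (E₁ ∪ (E₂ ∪ (E₃ ∪ (E₄ ∪ E₅))))) := by
    simpa using measureReal_mono (μ := P) hcover
  have u1 := measureReal_union_le (μ := P) G (E₁ ∪ (E₂ ∪ (E₃ ∪ (E₄ ∪ E₅))))
  have u2 := measureReal_union_le (μ := P) E₁ (E₂ ∪ (E₃ ∪ (E₄ ∪ E₅)))
  have u3 := measureReal_union_le (μ := P) E₂ (E₃ ∪ (E₄ ∪ E₅))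
  have u4 := measureReal_union_le (μ := P) E₃ (E₄ ∪ E₅)
  have u5 := measureReal_union_le (μ := P) E₄ E₅
  linarith

theorem lambdaMin_fin_zero (x : Fin 0 → EuclideanSpace ℝ (Fin n)) : lambdaMin x = 0 := by
  simp [lambdaMin, spectrum.of_subsingleton]

end

end TrainedNet

end

theorem mainTheorem6 :
    ∃ c : ℝ, 0 < c ∧ ∀ C : ℝ, ∃ K : ℝ, 0 < K ∧
      ∀ (n N m : ℕ) (x : Fin N → EuclideanSpace ℝ (Fin n)) (y : EuclideanSpace ℝ (Fin N))
        (δ η : ℝ),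
        (∀ i, ‖x i‖ = 1) → (∀ i, |y i| ≤ C) →
        0 < TrainedNet.lambdaMin x → 0 < δ →
        K * ((N : ℝ) ^ 6 / (TrainedNet.lambdaMin x ^ 4 * δ ^ 3)) ≤ (m : ℝ) →
        0 < η → η ≤ c * (TrainedNet.lambdaMin x / (N : ℝ) ^ 2) →
        ∀ (Ω : Type*) [MeasurableSpace Ω] (P : Measure Ω) [IsProbabilityMeasure P]
          (W₀ : Ω → Matrix (Fin m) (Fin n) ℝ) (a : Ω → Fin m → ℝ),
          TrainedNet.IsRandomInit P W₀ a →
          ∀ (X : Finset (EuclideanSpace ℝ (Fin n))) (r ε : ℝ),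
            0 < r → 0 < ε → ε < 1 →
            TrainedNet.GapCondition r ε (X : Set (EuclideanSpace ℝ (Fin n))) →
            1 - δ - (X.card : ℝ) * ((X.card : ℝ) - 1) *
                Real.exp ((m : ℝ) / 4 * (ε ^ 3 / 8 - ε ^ 2 / 4)) ≤
              P.real {ω |
                64 * (N : ℝ) * ‖TrainedNet.prediction x (a ω) (W₀ ω) - y‖ ^ 2 /
                    (ε ^ 2 * TrainedNet.lambdaMin x ^ 2) ≤ (m : ℝ) →
                ∀ l : ℕ,
                  TrainedNet.IsRGraphIso r (X : Set (EuclideanSpace ℝ (Fin n)))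
                    (TrainedNet.preAct (TrainedNet.gradDescent x y (a ω) η (W₀ ω) l))} := by
  refine ⟨1 / 4, by norm_num, fun C => ⟨55296 * (1 + C ^ 2), by positivity, ?_⟩⟩
  intro n N m x y δ η hx hy hpos hδ hmK hη hηc Ω _ P _ W₀ a h X r ε _ hε0 hε1 hgap
  -- for an empty training set `lambdaMin` is the junk value `sInf ∅ = 0`
  have hN : 0 < N := by
    rcases Nat.eq_zero_or_pos N with rfl | hN
    · exact absurd hpos (by rw [TrainedNet.lambdaMin_fin_zero]; exact lt_irrefl 0)
    · exact hN
  have hN' : (0 : ℝ) < N := by exact_mod_cast hN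
  have hm : 0 < m := by
    have : (0 : ℝ) < m := lt_of_lt_of_le (by positivity) hmK
    exact_mod_cast this
  rcases lt_or_ge δ 1 with hδ1 | hδ1
  · exact h.le_measureReal_isRGraphIso hx hy hpos hδ hδ1 hN hm hmK hη hηc hε0 hε1 hgap
  · -- the lower bound on the probability is not positive
    have hX : 0 ≤ (X.card : ℝ) * ((X.card : ℝ) - 1) := by
      rcases Nat.eq_zero_or_pos X.card with h0 | h0
      · simp [h0]
      · have : (1 : ℝ) ≤ X.card := by exact_mod_cast h0
        exact mul_nonneg (by linarith) (by linarith)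
    refine le_trans ?_ measureReal_nonneg
    have := mul_nonneg hX (Real.exp_pos ((m : ℝ) / 4 * (ε ^ 3 / 8 - ε ^ 2 / 4))).le
    linarith
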